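/- Let $f:\mathbb R^n\to\mathbb R$ and $g:\mathbb R^n\to\mathbb R^m$ be twice continuously differentiable, $K\subset\mathbb R^m$ closed, $\Phi:=\{x: g(x)\in K\}$, let $S$ be the set of (global) optimal solutions of $\min f(x)$ s.t. $g(x)\in K$, and $L(x,\lambda):=f(x)+g(x)^T\lambda$. Notation. $B_r(x)$ is the open ball, ${\rm dist}(x,\emptyset)=+\infty$, and $t_k\downarrow0$ means $t_k>0$, $t_k\to0$. For a set $A$ and points $x\in A$, $d$: - $T_A(x)=\{d:\exists t_k\downarrow0,\ d_k\to d,\ x+t_kd_k\in A\}$; - $T_A^2(x;d)=\{w:\exists t_k\downarrow0,\ w_k\to w,\ x+t_kd+\frac12t_k^2w_k\in A\}$; - $T_A''(x;d)=\{w:\exists t_k\downarrow0,\ r_k\downarrow 0,\ w_k\to w,\ t_k/r_k\to0,\ x+t_kd+\frac12t_kr_kw_k\in A\}$; - $\hat N_A(x)=\{v:\limsup_{z\to x,\,z\in A}\langle v,z-x\rangle/\|z-x\|\le0\}$ is the Fréchet normal cone and $N_A(x)=\{v:\exists x_k\to x,\ v_k\to v,\ x_k\in A,\ v_k\in\hat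 N_A(x_k)\}$ the limiting normal cone (both empty at points outside $A$); - $N_A(x;d)=\{v:\exists t_k\downarrow0,\ d_k\to d,\ v_k\to v,\ v_k\in\hat N_A(x+t_kd_k)\}$ is the directional limiting normal cone; - $N^P_A(x)=\{v:\exists\tau>0,\ x\in {\rm cl}\,A,\ \|\tau v\|={\rm dist}(x+\tau v,A)\}$ and $N^{P,\varepsilon}_A(x)=\{v:{\rm dist}(v,N^P_A(x))\le\varepsilon\|v\|\}$. For $Q\subset\mathbb R^m$ nonempty and closed and $A\subset\mathbb R^m$, the lower generalized support function is $$\hat\sigma_{Q,A}(\lambda)=\liminf_{\lambda'\to\lambda}\ \inf\{\langle\lambda',u\rangle : u\in A,\ \lambda'\in N_Q(u)\}\in[-\infty,+\infty]$$ (with $\lambda'=\lambda$ admitted and $\inf\emptyset=+\infty$); $\hat\sigma_{\emptyset,A}\equiv-\infty$, and $\hat\sigma_Q:=\hat\sigma_{Q,\mathbb R^m}$. For $x\in\Phi$ put $$C(x)=\{d:\nabla g(x)d\in T_K(g(x)),\ \nabla f(x)d\le0\},$$ $$\Lambda(x;d)=\{\lambda:\nabla_xL(x,\lambda)=0,\ \lambda\in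 N_K(g(x);\nabla g(x)d)\},$$ $$\Theta(x;d)=\nabla g(x)(T_\Phi''(x;d)),\qquad \Omega(x;d)=\nabla g(x)(T_\Phi^2(x;d))+\nabla^2g(x)(d,d).$$ **Theorem.** Let $\bar x\in\Phi$ be a local second-order weak sharp minimizer with constants $\kappa,\delta>0$, i.e. $f(x)\ge f(\bar x)+\kappa\,{\rm dist}(x,S)^2$ for all $x\in\Phi\cap B_\delta(\bar x)$. Suppose that the metric subregularity constraint qualification (MSCQ) holds at $\bar x$, i.e. there are $r,c>0$ with ${\rm dist}(x,\Phi)\le c\,{\rm dist}(g(x),K)$ whenever $\|x-\bar x\|\le r$. Then for every $\varepsilon\in[0,1/2)$ there exists $\delta'\in(0,\delta)$ such that for every $x\in S\cap B_{\delta'}(\bar x)$ and every $d\in C(x)\cap N_S^{P,\varepsilon}(x)$: (i) There exists $\lambda\in\Lambda(x;d)$ such that $\hat\sigma_{T_K''(g(x);\nabla g(x)d),A}(\lambda)\le0$ for every set $A\supset\Theta(x;d)$; in particular $\hat\sigma_{T_K''(g(x);\nabla g(x)d)}(\lambda)\le0$. (ii) If $T_K^2(g(x);\nabla g(x)d)\ne\emptyset$,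 then there exists $\lambda\in\Lambda(x;d)$ such that for every set $B\supset\Omega(x;d)$ $$\nabla^2_{xx}L(x,\lambda)(d,d)-\hat\sigma_{T_K^2(g(x);\nabla g(x)d),B}(\lambda)\ge2\kappa(1-2\varepsilon)^2\|d\|^2;$$ in particular $$\nabla^2_{xx}L(x,\lambda)(d,d)-\hat\sigma_{T_K^2(g(x);\nabla g(x)d)}(\lambda)\ge2\kappa(1-2\varepsilon)^2\|d\|^2.$$ Moreover, for every $x\in S\cap B_{\delta'}(\bar x)$ and every $d\in C(x)$, (i) and (ii) hold with the right-hand side $2\kappa(1-2\varepsilon)^2\|d\|^2$ in both inequalities of (ii) replaced by $2\kappa\,{\rm dist}(d,T_S(x))^2$. -/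

import Mathlib

open Filter Topology

noncomputable section

namespace WeakSharp

section Cones

variable {E : Type*} [NormedAddCommGroup E] [InnerProductSpace ℝ E]

/-- The contingent (Bouligand–Severi) tangent cone `T_A(x)`. The notation `t_k ↓ 0` means
`t_k > 0` and `t_k → 0`, here and below. -/
def tangentCone (A : Set E) (x : E) : Set E :=
  {d | ∃ (t : ℕ → ℝ) (d' : ℕ → E), (∀ k, 0 < t k) ∧ Tendsto t atTop (𝓝 0) ∧
    Tendsto d' atTop (𝓝 d) ∧ ∀ k, x + t k • d' k ∈ A}

/-- The outer second-order tangent set `T_A^2(x; d)`. -/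
def outerSecondTangent (A : Set E) (x d : E) : Set E :=
  {w | ∃ (t : ℕ → ℝ) (w' : ℕ → E), (∀ k, 0 < t k) ∧ Tendsto t atTop (𝓝 0) ∧
    Tendsto w' atTop (𝓝 w) ∧ ∀ k, x + t k • d + ((1 / 2 : ℝ) * t k ^ 2) • w' k ∈ A}

/-- The asymptotic second-order tangent cone `T_A''(x; d)`. -/
def asymptoticSecondTangent (A : Set E) (x d : E) : Set E :=
  {w | ∃ (t r : ℕ → ℝ) (w' : ℕ → E), (∀ k, 0 < t k) ∧ (∀ k, 0 < r k) ∧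
    Tendsto t atTop (𝓝 0) ∧ Tendsto r atTop (𝓝 0) ∧
    Tendsto (fun k => t k / r k) atTop (𝓝 0) ∧
    Tendsto w' atTop (𝓝 w) ∧ ∀ k, x + t k • d + ((1 / 2 : ℝ) * t k * r k) • w' k ∈ A}

/-- The Fréchet normal cone: `v` with `limsup ⟪v, z - x⟫ / ‖z - x‖ ≤ 0` as `z → x` in `A`.
It is empty at points outside `A`. -/
def frechetNormal (A : Set E) (x : E) : Set E :=
  {v | x ∈ A ∧ ∀ ε : ℝ, 0 < ε → ∀ᶠ z in 𝓝[A] x, inner ℝ v (z - x) ≤ ε * ‖z - x‖}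

/-- The limiting (Mordukhovich) normal cone `N_A(x)`; empty at points outside `A`. -/
def limitingNormal (A : Set E) (x : E) : Set E :=
  {v | x ∈ A ∧ ∃ (x' v' : ℕ → E), Tendsto x' atTop (𝓝 x) ∧ Tendsto v' atTop (𝓝 v) ∧
    ∀ k, v' k ∈ frechetNormal A (x' k)}

/-- The limiting normal cone `N_A(x; d)` in direction `d`. -/
def dirLimitingNormal (A : Set E) (x d : E) : Set E :=
  {v | ∃ (t : ℕ → ℝ) (d' v' : ℕ → E), (∀ k, 0 < t k) ∧ Tendsto t atTop (𝓝 0) ∧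
    Tendsto d' atTop (𝓝 d) ∧ Tendsto v' atTop (𝓝 v) ∧
    ∀ k, v' k ∈ frechetNormal A (x + t k • d' k)}

/-- The projection `P_A(x) = {w ∈ cl A | ‖x - w‖ = dist(x, A)}`. -/
def proj (A : Set E) (x : E) : Set E :=
  {w | w ∈ closure A ∧ ‖x - w‖ = Metric.infDist x A}

/-- The proximal normal cone. -/
def proximalNormal (A : Set E) (x : E) : Set E :=
  {v | ∃ τ : ℝ, 0 < τ ∧ x ∈ proj A (x + τ • v)}

/-- The `ε`-proximal normal cone (the distance is to a set that contains `0` when `x ∈ A`). -/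
def epsProximalNormal (ε : ℝ) (A : Set E) (x : E) : Set E :=
  {v | Metric.infDist v (proximalNormal A x) ≤ ε * ‖v‖}

/-- The directional neighborhood `V_{ρ,δ}(d)`. -/
def dirNhd (ρ δ : ℝ) (d : E) : Set E :=
  {w | ‖w‖ ≤ δ ∧ ‖‖d‖ • w - ‖w‖ • d‖ ≤ ρ * ‖w‖ * ‖d‖}

open Classical in
/-- The lower generalized support function of `Q` with respect to `A`:
`liminf_{l' → l} inf {⟪l', u⟫ | l' ∈ N_Q(u), u ∈ A}`, with value `-∞` when `Q = ∅`. As usual in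
variational analysis, `l' = l` is admitted in the lower limit, and the infimum over the empty
set is `+∞`. -/
def lowerGenSupport (Q A : Set E) (l : E) : EReal :=
  if Q = ∅ then ⊥
  else liminf (fun l' : E =>
    ⨅ u ∈ {u : E | l' ∈ limitingNormal Q u} ∩ A, ((inner ℝ l' u : ℝ) : EReal)) (𝓝 l)

/-- The second derivative of `h` at `x` as a quadratic form, `∇²h(x)(d, d)`. -/
def secondDeriv {F : Type*} [NormedAddCommGroup F] [NormedSpace ℝ F] (h : E → F) (x d : E) : F :=
  fderiv ℝ (fderiv ℝ h) x d d

end Cones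

section Problem

variable {n m : ℕ} (f : EuclideanSpace ℝ (Fin n) → ℝ)
  (g : EuclideanSpace ℝ (Fin n) → EuclideanSpace ℝ (Fin m))
  (K : Set (EuclideanSpace ℝ (Fin m)))

/-- The feasible set `Φ = g⁻¹(K)`. -/
def feasible : Set (EuclideanSpace ℝ (Fin n)) := {x | g x ∈ K}

/-- The set `S` of optimal solutions of `min f(x) s.t. g(x) ∈ K`. -/
def solutions : Set (EuclideanSpace ℝ (Fin n)) :=
  {x | x ∈ feasible g K ∧ ∀ z ∈ feasible g K, f x ≤ f z}

/-- `xbar` is a local second-order weak sharp minimizer with constants `κ` and `δ`. Since the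
distance to the empty set is `+∞`, the growth condition forces `S ≠ ∅`; this is stated separately
because `Metric.infDist` is real-valued. -/
def IsWeakSharpMinimizer (xbar : EuclideanSpace ℝ (Fin n)) (κ δ : ℝ) : Prop :=
  0 < κ ∧ 0 < δ ∧ xbar ∈ feasible g K ∧ (solutions f g K).Nonempty ∧
    ∀ x ∈ feasible g K ∩ Metric.ball xbar δ,
      f x ≥ f xbar + κ * Metric.infDist x (solutions f g K) ^ 2

/-- The metric subregularity constraint qualification for `g(x) ∈ K` at `xbar` in direction `d`. -/
def DirMSCQ (xbar d : EuclideanSpace ℝ (Fin n)) : Prop :=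
  xbar ∈ feasible g K ∧ ∃ ρ δ κ : ℝ, 0 < ρ ∧ 0 < δ ∧ 0 < κ ∧ ∀ w ∈ dirNhd ρ δ d,
    Metric.infDist (xbar + w) (feasible g K) ≤ κ * Metric.infDist (g (xbar + w)) K

/-- The (nondirectional) metric subregularity constraint qualification. -/
def MSCQ (xbar : EuclideanSpace ℝ (Fin n)) : Prop := DirMSCQ g K xbar 0

/-- The critical cone `C(x)`. -/
def criticalCone (x : EuclideanSpace ℝ (Fin n)) : Set (EuclideanSpace ℝ (Fin n)) :=
  {d | fderiv ℝ g x d ∈ tangentCone K (g x) ∧ fderiv ℝ f x d ≤ 0}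

/-- The Lagrange function `L(x, l) = f(x) + g(x)ᵀ l`. -/
def lagrangian (x : EuclideanSpace ℝ (Fin n)) (l : EuclideanSpace ℝ (Fin m)) : ℝ :=
  f x + inner ℝ (g x) l

/-- The set `Λ(x; d)` of M-multipliers in direction `d`. -/
def dirMultipliers (x d : EuclideanSpace ℝ (Fin n)) : Set (EuclideanSpace ℝ (Fin m)) :=
  {l | fderiv ℝ (fun z => lagrangian f g z l) x = 0 ∧
    l ∈ dirLimitingNormal K (g x) (fderiv ℝ g x d)}

/-- `Θ(x; d) = ∇g(x)(T_Φ''(x; d))`. -/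
def thetaSet (x d : EuclideanSpace ℝ (Fin n)) : Set (EuclideanSpace ℝ (Fin m)) :=
  (fun w => fderiv ℝ g x w) '' asymptoticSecondTangent (feasible g K) x d

/-- `Ω(x; d) = ∇g(x)(T_Φ²(x; d)) + ∇²g(x)(d, d)`. -/
def omegaSet (x d : EuclideanSpace ℝ (Fin n)) : Set (EuclideanSpace ℝ (Fin m)) :=
  (fun w => fderiv ℝ g x w + secondDeriv g x d) '' outerSecondTangent (feasible g K) x d

/-- `T_K''(g(x); ∇g(x)d)`. -/
def imageAsymptotic (x d : EuclideanSpace ℝ (Fin n)) : Set (EuclideanSpace ℝ (Fin m)) :=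
  asymptoticSecondTangent K (g x) (fderiv ℝ g x d)

/-- `T_K²(g(x); ∇g(x)d)`. -/
def imageOuter (x d : EuclideanSpace ℝ (Fin n)) : Set (EuclideanSpace ℝ (Fin m)) :=
  outerSecondTangent K (g x) (fderiv ℝ g x d)

/-- Assertion (i) at `x` in direction `d`. -/
def FirstAssertion (x d : EuclideanSpace ℝ (Fin n)) : Prop :=
  ∃ l ∈ dirMultipliers f g K x d,
    (∀ A : Set (EuclideanSpace ℝ (Fin m)), thetaSet g K x d ⊆ A →
      lowerGenSupport (imageAsymptotic g K x d) A l ≤ 0) ∧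
    lowerGenSupport (imageAsymptotic g K x d) Set.univ l ≤ 0

/-- Assertion (ii) at `x` in direction `d`, with the lower bound `c` on its right-hand side. The
first term of the difference is a real number, so the subtraction in `EReal` is never `∞ - ∞`. -/
def SecondAssertion (x d : EuclideanSpace ℝ (Fin n)) (c : ℝ) : Prop :=
  (imageOuter g K x d).Nonempty →
    ∃ l ∈ dirMultipliers f g K x d,
      (∀ B : Set (EuclideanSpace ℝ (Fin m)), omegaSet g K x d ⊆ B →
        ((secondDeriv (fun z => lagrangian f g z l) x d : ℝ) : EReal) -
          lowerGenSupport (imageOuter g K x d) B l ≥ (c : EReal)) ∧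
      ((secondDeriv (fun z => lagrangian f g z l) x d : ℝ) : EReal) -
        lowerGenSupport (imageOuter g K x d) Set.univ l ≥ (c : EReal)

end Problem

end WeakSharp

end

/-! Fix `x` in `S` near `xbar`. Growth and MSCQ hold around `x` with the same constants, because `f
x ≤ f xbar`. Both assertions are one argument for second-order tangents with `t/r → σ`: `σ = 0` for
(i), `σ = 1` for (ii).

Expanding `f` along feasible points `x + t d + ½ t r w'` and dividing by `½ t r` turns quadratic
growth into a lower bound for the linear function `∇f(x)` on the second-order tangents of `Φ`
(`second_order_growth`). The same scaling turns MSCQ into a global error bound describing these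
tangents by `∇g(x) w + σ ∇²g(x)(d,d) ∈ Q`, with `Q` the second-order tangents of `K`
(`exists_secondTangent_near`). What remains is to bound a linear function below under an inclusion
with an error bound.

Exact penalization gives multipliers in the limiting normal cone of `Q`. For `σ = 0` the minimum is
attained at `0` (`exists_multiplier`). For `σ = 1` it need not be attained; near-minimizers carry
bounded multipliers, and their limit accounts for the lower limit in the support function
(`exists_asymptotic_multiplier`). Normals to `Q` are normals to `K` in direction `∇g(x) d`
(`frechetNormal_secondTangent_subset`), so the limits lie in `Λ(x; d)`. The base points lie in `Θ`
or `Ω`, so one multiplier serves every `A` or `B`. -/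

namespace WeakSharp

/-! ### Second-order tangents and Fréchet normals -/

section

variable {E : Type*} [NormedAddCommGroup E] [InnerProductSpace ℝ E]

/-- Second-order tangents with ratio `σ`: the asymptotic second-order tangent cone is the case
`σ = 0`, the outer second-order tangent set the case `σ = 1`. -/
def secondTangent (σ : ℝ) (A : Set E) (x d : E) : Set E :=
  {w | ∃ (t r : ℕ → ℝ) (w' : ℕ → E), (∀ k, 0 < t k) ∧ (∀ k, 0 < r k) ∧
    Tendsto t atTop (𝓝 0) ∧ Tendsto r atTop (𝓝 0) ∧
    Tendsto (fun k => t k / r k) atTop (𝓝 σ) ∧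
    Tendsto w' atTop (𝓝 w) ∧ ∀ k, x + t k • d + ((1 / 2 : ℝ) * t k * r k) • w' k ∈ A}

theorem outerSecondTangent_eq (A : Set E) (x d : E) :
    outerSecondTangent A x d = secondTangent 1 A x d := by
  ext w
  constructor
  · rintro ⟨t, w', ht, ht0, hw, hA⟩
    refine ⟨t, t, w', ht, ht, ht0, ht0, ?_, hw, fun k => ?_⟩
    · simp [div_self (ht _).ne']
    · convert hA k using 3
      ring
  · rintro ⟨t, r, w', ht, hr, ht0, hr0, htr, hw, hA⟩
    -- Since `t/r → 1`, rescaling `w'` by `r/t` changes the scale `t r` to `t²` without moving the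
    -- limit.
    refine ⟨t, fun k => (t k / r k)⁻¹ • w' k, ht, ht0, ?_, fun k => ?_⟩
    · simpa using (htr.inv₀ one_ne_zero).smul hw
    · convert hA k using 2
      rw [smul_smul]
      congr 1
      have := (ht k).ne'
      have := (hr k).ne'
      field_simp

theorem tendsto_of_norm_sub_lt {F : Type*} [NormedAddCommGroup F] {a : ℕ → F} {l : F}
    (h : ∀ k : ℕ, ‖a k - l‖ < 1 / ((k : ℝ) + 1)) : Tendsto a atTop (𝓝 l) := by
  rw [tendsto_iff_norm_sub_tendsto_zero]
  exact squeeze_zero (fun _ => norm_nonneg _) (fun k => (h k).le)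
    tendsto_one_div_add_atTop_nhds_zero_nat

/-- With a single tolerance in place of sequences, closedness needs no diagonal sequence. -/
theorem mem_secondTangent_iff {σ : ℝ} {A : Set E} {x d w : E} :
    w ∈ secondTangent σ A x d ↔ ∀ ε : ℝ, 0 < ε → ∃ (t r : ℝ) (w' : E), 0 < t ∧ 0 < r ∧ t < ε ∧
      r < ε ∧ ‖t / r - σ‖ < ε ∧ ‖w' - w‖ < ε ∧ x + t • d + ((1 / 2 : ℝ) * t * r) • w' ∈ A := by
  constructor
  · rintro ⟨t, r, w', ht, hr, ht0, hr0, htr, hw, hA⟩ ε hε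
    rw [tendsto_iff_norm_sub_tendsto_zero] at htr hw
    obtain ⟨k, h1, h2, h3, h4⟩ := ((ht0.eventually_lt_const hε).and
      ((hr0.eventually_lt_const hε).and ((htr.eventually_lt_const hε).and
      (hw.eventually_lt_const hε)))).exists
    exact ⟨t k, r k, w' k, ht k, hr k, h1, h2, h3, h4, hA k⟩
  · intro h
    choose t r w' ht hr h1 h2 h3 h4 hA using fun k : ℕ =>
      h (1 / ((k : ℝ) + 1)) Nat.one_div_pos_of_nat
    refine ⟨t, r, w', ht, hr, tendsto_of_norm_sub_lt fun k => ?_,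
      tendsto_of_norm_sub_lt fun k => ?_, tendsto_of_norm_sub_lt h3, tendsto_of_norm_sub_lt h4, hA⟩
    · simpa [abs_of_pos (ht k)] using h1 k
    · simpa [abs_of_pos (hr k)] using h2 k

theorem isClosed_secondTangent (σ : ℝ) (A : Set E) (x d : E) :
    IsClosed (secondTangent σ A x d) := by
  refine isClosed_of_closure_subset fun w hw => mem_secondTangent_iff.2 fun ε hε => ?_
  obtain ⟨v, hv, hvw⟩ := Metric.mem_closure_iff.1 hw (ε / 2) (half_pos hε)
  obtain ⟨t, r, w', ht, hr, h1, h2, h3, h4, hA⟩ := mem_secondTangent_iff.1 hv (ε / 2) (half_pos hε)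
  refine ⟨t, r, w', ht, hr, by linarith, by linarith, by linarith, ?_, hA⟩
  rw [dist_comm, dist_eq_norm] at hvw
  calc ‖w' - w‖ ≤ ‖w' - v‖ + ‖v - w‖ := norm_sub_le_norm_sub_add_norm_sub ..
    _ < ε := by linarith

theorem mem_dirLimitingNormal_of_forall {A : Set E} {x d v : E}
    (h : ∀ ε : ℝ, 0 < ε → ∃ (t : ℝ) (d' v' : E), 0 < t ∧ t < ε ∧ ‖d' - d‖ < ε ∧ ‖v' - v‖ < ε ∧
      v' ∈ frechetNormal A (x + t • d')) : v ∈ dirLimitingNormal A x d := by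
  choose t d' v' ht h1 h2 h3 hA using fun k : ℕ =>
    h (1 / ((k : ℝ) + 1)) Nat.one_div_pos_of_nat
  refine ⟨t, d', v', ht, tendsto_of_norm_sub_lt fun k => ?_, tendsto_of_norm_sub_lt h2,
    tendsto_of_norm_sub_lt h3, hA⟩
  simpa [abs_of_pos (ht k)] using h1 k

theorem isClosed_dirLimitingNormal (A : Set E) (x d : E) :
    IsClosed (dirLimitingNormal A x d) := by
  refine isClosed_of_closure_subset fun w hw => mem_dirLimitingNormal_of_forall fun ε hε => ?_
  obtain ⟨v, ⟨t, d', v', ht, ht0, hd, hv, hA⟩, hvw⟩ := Metric.mem_closure_iff.1 hw (ε / 2)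
    (half_pos hε)
  rw [tendsto_iff_norm_sub_tendsto_zero] at hd hv
  obtain ⟨k, h1, h2, h3⟩ := ((ht0.eventually_lt_const hε).and
    ((hd.eventually_lt_const hε).and (hv.eventually_lt_const (half_pos hε)))).exists
  refine ⟨t k, d' k, v' k, ht k, h1, h2, ?_, hA k⟩
  rw [dist_comm, dist_eq_norm] at hvw
  calc ‖v' k - w‖ ≤ ‖v' k - v‖ + ‖v - w‖ := norm_sub_le_norm_sub_add_norm_sub ..
    _ < ε := by linarith

theorem smul_mem_frechetNormal {A : Set E} {x v : E} (hv : v ∈ frechetNormal A x) {a : ℝ}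
    (ha : 0 < a) : a • v ∈ frechetNormal A x := by
  refine ⟨hv.1, fun ε hε => ?_⟩
  filter_upwards [hv.2 (ε / a) (div_pos hε ha)] with z hz
  rw [real_inner_smul_left]
  calc a * inner ℝ v (z - x) ≤ a * (ε / a * ‖z - x‖) := by gcongr
    _ = ε * ‖z - x‖ := by field_simp

/-- The vector from a nearest point of `A` is a Fréchet normal. -/
theorem sub_mem_frechetNormal_of_nearest {A : Set E} {z p : E} (hz : z ∈ A)
    (h : ∀ z' ∈ A, ‖p - z‖ ≤ ‖p - z'‖) : p - z ∈ frechetNormal A z := by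
  refine ⟨hz, fun ε hε => ?_⟩
  filter_upwards [self_mem_nhdsWithin, mem_nhdsWithin_of_mem_nhds (Metric.ball_mem_nhds z hε)]
    with z' hz' hball
  have h1 := pow_le_pow_left₀ (norm_nonneg _) (h z' hz') 2
  have h2 : p - z' = (p - z) - (z' - z) := by abel
  rw [h2, norm_sub_sq_real (p - z)] at h1
  rw [mem_ball_iff_norm] at hball
  nlinarith [norm_nonneg (z' - z)]

/-- At a local minimizer on `A`, the negative gradient is a Fréchet normal. -/
theorem mem_frechetNormal_of_isLocalMinOn {A : Set E} {u v : E} {G : E → ℝ} (hu : u ∈ A)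
    (hmin : IsLocalMinOn G A u) (hG : HasFDerivAt G (innerSL ℝ (-v)) u) :
    v ∈ frechetNormal A u := by
  refine ⟨hu, fun ε hε => ?_⟩
  filter_upwards [hmin, mem_nhdsWithin_of_mem_nhds (hG.isLittleO.def hε)] with z hz hlo
  simp only [innerSL_apply_apply, inner_neg_left, Real.norm_eq_abs] at hlo
  have hz' : G u ≤ G z := hz
  linarith [le_abs_self (G z - G u - -inner ℝ v (z - u))]

end

/-! ### Normals to second-order tangents are directional normals -/

section

variable {F : Type*} [NormedAddCommGroup F] [InnerProductSpace ℝ F] [FiniteDimensional ℝ F]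

/-- Step from `u` by `s • l`, rescale to the level of `K` and project onto `K`: the residuals are
Fréchet normals to `K`. The rescaled projections cluster at a second-order tangent `z₀` no farther
from `u + s • l` than `u` is. As `l` is normal at `u`, this forces `‖z₀ - u‖ < s * ε`, so the
residuals divided by `s` are `ε`-close to `l`. -/
theorem frechetNormal_secondTangent_subset {σ : ℝ} {K : Set F} (hK : IsClosed K) {y d u l : F}
    (hl : l ∈ frechetNormal (secondTangent σ K y d) u) : l ∈ dirLimitingNormal K y d := by
  refine mem_dirLimitingNormal_of_forall fun ε hε => ?_
  obtain ⟨hu, hl⟩ := hl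
  obtain ⟨ρ, hρ, hball⟩ := Metric.mem_nhdsWithin_iff.1 (hl (ε / 4) (by positivity))
  -- The nearest-point property will give `‖z₀ - u‖ ≤ 2 s ‖l‖`; this `s` keeps `z₀` where the
  -- Fréchet inequality holds.
  obtain ⟨s, hs, hsρ⟩ : ∃ s : ℝ, 0 < s ∧ 2 * s * ‖l‖ < ρ := by
    refine ⟨ρ / (2 * (‖l‖ + 1)), by positivity, ?_⟩
    have : 2 * (ρ / (2 * (‖l‖ + 1))) * ‖l‖ = ρ * (‖l‖ / (‖l‖ + 1)) := by field_simp
    rw [this]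
    refine mul_lt_of_lt_one_right hρ ?_
    rw [div_lt_one (by positivity)]
    linarith
  obtain ⟨t, r, w, ht, hr, ht0, hr0, htr, hw, hA⟩ := hu
  have ha : ∀ k, 0 < (1 / 2 : ℝ) * t k * r k := fun k => by
    have := ht k
    have := hr k
    positivity
  choose Z hZK hZ using fun k => hK.exists_infDist_eq_dist ⟨_, hA k⟩
    (y + t k • d + ((1 / 2 : ℝ) * t k * r k) • (u + s • l))
  obtain ⟨z, hZz⟩ : ∃ z : ℕ → F, ∀ k, Z k = y + t k • d + ((1 / 2 : ℝ) * t k * r k) • z k := by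
    refine ⟨fun k => ((1 / 2 : ℝ) * t k * r k)⁻¹ • (Z k - y - t k • d), fun k => ?_⟩
    simp only [smul_smul, mul_inv_cancel₀ (ha k).ne', one_smul]
    abel
  have hdiff : ∀ k v, y + t k • d + ((1 / 2 : ℝ) * t k * r k) • (u + s • l) -
      (y + t k • d + ((1 / 2 : ℝ) * t k * r k) • v) =
      ((1 / 2 : ℝ) * t k * r k) • (u + s • l - v) := fun k v => by
    rw [smul_sub]
    abel
  have hnear : ∀ k, ∀ v ∈ K,
      ‖y + t k • d + ((1 / 2 : ℝ) * t k * r k) • (u + s • l) - Z k‖ ≤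
      ‖y + t k • d + ((1 / 2 : ℝ) * t k * r k) • (u + s • l) - v‖ := fun k v hv => by
    rw [← dist_eq_norm, ← dist_eq_norm, ← hZ k]
    exact Metric.infDist_le_dist_of_mem hv
  have hle : ∀ k, ‖u + s • l - z k‖ ≤ ‖u + s • l - w k‖ := fun k => by
    have := hnear k _ (hA k)
    rw [hZz k, hdiff, hdiff, norm_smul, norm_smul, Real.norm_of_nonneg (ha k).le] at this
    exact le_of_mul_le_mul_left this (ha k)
  have hlim : Tendsto (fun k => ‖u + s • l - w k‖) atTop (𝓝 ‖u + s • l - u‖) :=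
    (tendsto_const_nhds.sub hw).norm
  obtain ⟨C, hC⟩ := hlim.bddAbove_range
  have hbdd : ∀ k, z k ∈ Metric.closedBall (u + s • l) C := fun k => by
    rw [mem_closedBall_iff_norm, norm_sub_rev]
    exact (hle k).trans (hC ⟨k, rfl⟩)
  obtain ⟨z₀, -, φ, hφ, hzφ⟩ := tendsto_subseq_of_bounded Metric.isBounded_closedBall hbdd
  have hφt := hφ.tendsto_atTop
  have hz₀ : z₀ ∈ secondTangent σ K y d :=
    ⟨t ∘ φ, r ∘ φ, z ∘ φ, fun k => ht _, fun k => hr _, ht0.comp hφt, hr0.comp hφt,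
      htr.comp hφt, hzφ, fun k => by simpa only [Function.comp, ← hZz] using hZK (φ k)⟩
  have hz₀le : ‖u + s • l - z₀‖ ≤ ‖u + s • l - u‖ :=
    le_of_tendsto_of_tendsto' (tendsto_const_nhds.sub hzφ).norm (hlim.comp hφt)
      fun k => hle (φ k)
  have hsq : ‖z₀ - u‖ ^ 2 ≤ 2 * s * inner ℝ l (z₀ - u) := by
    have h1 := pow_le_pow_left₀ (norm_nonneg _) hz₀le 2
    have h2 : u + s • l - z₀ = s • l - (z₀ - u) := by abel
    rw [h2, add_sub_cancel_left, norm_sub_sq_real, real_inner_smul_left] at h1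
    linarith
  have hρ' : ‖z₀ - u‖ < ρ := by
    refine lt_of_le_of_lt ?_ hsρ
    have := real_inner_le_norm l (z₀ - u)
    by_contra! hcon
    have : 0 < ‖z₀ - u‖ := lt_of_le_of_lt (by positivity) hcon
    nlinarith
  have hin : inner ℝ l (z₀ - u) ≤ ε / 4 * ‖z₀ - u‖ :=
    hball ⟨mem_ball_iff_norm.2 hρ', hz₀⟩
  have hzs : ‖z₀ - u‖ < s * ε := by
    by_contra! hcon
    have : 0 < ‖z₀ - u‖ := lt_of_lt_of_le (by positivity) hcon
    nlinarith [mul_pos hs hε]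
  have e1 : ∀ᶠ k in atTop, ‖z (φ k) - u‖ < s * ε :=
    ((hzφ.sub_const u).norm).eventually_lt_const hzs
  have e2 : Tendsto (fun k => ‖((1 / 2 : ℝ) * r (φ k)) • z (φ k)‖) atTop (𝓝 0) := by
    simpa using (((hr0.comp hφt).const_mul (1 / 2 : ℝ)).smul hzφ).norm
  obtain ⟨k, k1, k2, k3⟩ := (e1.and ((e2.eventually_lt_const hε).and
    ((ht0.comp hφt).eventually_lt_const hε))).exists
  refine ⟨t (φ k), d + ((1 / 2 : ℝ) * r (φ k)) • z (φ k), s⁻¹ • (u + s • l - z (φ k)), ht _, k3,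
    by simpa using k2, ?_, ?_⟩
  · have : s⁻¹ • (u + s • l - z (φ k)) - l = s⁻¹ • (u - z (φ k)) := by
      rw [smul_sub, smul_add, smul_smul, inv_mul_cancel₀ hs.ne', one_smul, smul_sub]
      abel
    rw [this, norm_smul, norm_sub_rev, norm_inv, Real.norm_of_nonneg hs.le, inv_mul_lt_iff₀ hs]
    exact k1
  · have h1 := sub_mem_frechetNormal_of_nearest (hZK (φ k)) (hnear (φ k))
    rw [hZz, hdiff] at h1
    have h2 := smul_mem_frechetNormal h1 (a := s⁻¹ * ((1 / 2 : ℝ) * t (φ k) * r (φ k))⁻¹)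
      (mul_pos (inv_pos.2 hs) (inv_pos.2 (ha _)))
    rw [smul_smul, inv_mul_cancel_right₀ (ha _).ne'] at h2
    convert h2 using 1
    rw [smul_add, smul_smul, add_assoc]
    congr 3
    ring_nf

theorem limitingNormal_secondTangent_subset {σ : ℝ} {K : Set F} (hK : IsClosed K) {y d u l : F}
    (hl : l ∈ limitingNormal (secondTangent σ K y d) u) : l ∈ dirLimitingNormal K y d := by
  obtain ⟨-, u', l', -, hl', h⟩ := hl
  exact (isClosed_dirLimitingNormal K y d).mem_of_tendsto hl'
    (Eventually.of_forall fun k => frechetNormal_secondTangent_subset hK (h k))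

end

/-! ### Multipliers by smoothed exact penalization -/

section

variable {E F : Type*} [NormedAddCommGroup E] [InnerProductSpace ℝ E] [FiniteDimensional ℝ E]
  [NormedAddCommGroup F] [InnerProductSpace ℝ F] [FiniteDimensional ℝ F]

/-- `√(‖v‖² + a)` is a smooth majorant of the norm with gradient of norm at most one. It serves as
penalty (`a = s²`) and as coercive perturbation (`a = 1`). -/
theorem hasFDerivAt_sqrt_norm_sq_add {G : Type*} [NormedAddCommGroup G] [InnerProductSpace ℝ G]
    {a : ℝ} (ha : 0 < a) (v : G) :
    HasFDerivAt (fun v : G => Real.sqrt (‖v‖ ^ 2 + a))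
      (innerSL ℝ ((Real.sqrt (‖v‖ ^ 2 + a))⁻¹ • v)) v := by
  have hpos : ‖v‖ ^ 2 + a ≠ 0 := by positivity
  convert! ((hasStrictFDerivAt_norm_sq v).hasFDerivAt.add_const a).sqrt hpos using 1
  ext z
  simp
  ring

theorem norm_inv_sqrt_smul_le {G : Type*} [NormedAddCommGroup G] [InnerProductSpace ℝ G]
    {a : ℝ} (ha : 0 < a) (v : G) : ‖(Real.sqrt (‖v‖ ^ 2 + a))⁻¹ • v‖ ≤ 1 := by
  have hpos : 0 < Real.sqrt (‖v‖ ^ 2 + a) := Real.sqrt_pos.2 (by positivity)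
  rw [norm_smul, norm_inv, Real.norm_of_nonneg hpos.le, inv_mul_le_iff₀ hpos, mul_one]
  exact Real.le_sqrt_of_sq_le (by linarith)

theorem norm_le_sqrt_norm_sq_add {G : Type*} [NormedAddCommGroup G] {a : ℝ} (ha : 0 ≤ a) (v : G) :
    ‖v‖ ≤ Real.sqrt (‖v‖ ^ 2 + a) :=
  Real.le_sqrt_of_sq_le (by linarith)

/-- Approximate multipliers at a point that minimizes an exactly penalized problem. -/
theorem exists_approx_multiplier {A : E →L[ℝ] F} {b : F} {Q : Set F} (hQ : IsClosed Q) {M : ℝ}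
    (hM : 0 ≤ M) {h : E → ℝ} (hd : Differentiable ℝ h) {w₁ : E} (hw₁ : A w₁ + b ∈ Q)
    (hpen : ∀ w, ∀ q ∈ Q, h w₁ ≤ h w + M * ‖A w + b - q‖) {s : ℝ} (hs : 0 < s)
    (hMs : M * s < 1) :
    ∃ (w : E) (u l : F), ‖w - w₁‖ ^ 2 ≤ M * s ∧ ‖u - (A w₁ + b)‖ ^ 2 ≤ M * s ∧ ‖l‖ ≤ M ∧
      l - (2 : ℝ) • (u - (A w₁ + b)) ∈ frechetNormal Q u ∧
      ∀ v, fderiv ℝ h w v + 2 * inner ℝ (w - w₁) v + inner ℝ l (A v) = 0 := by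
  set u₁ := A w₁ + b with hu₁
  have hs2 : 0 < s ^ 2 := by positivity
  -- The inclusion is split into a variable `q ∈ Q` and a smoothed penalty. The two squares hold
  -- minimizers near `(w₁, u₁)`, where `G` exceeds `h w₁` by only `M * s`.
  set G : E × F → ℝ := fun p => h p.1 + ‖p.1 - w₁‖ ^ 2 +
    M * Real.sqrt (‖A p.1 + b - p.2‖ ^ 2 + s ^ 2) + ‖p.2 - u₁‖ ^ 2 with hG
  have hcont : Continuous G := by
    have := hd.continuous
    fun_prop
  obtain ⟨⟨w, u⟩, ⟨hwB, huQ, huB⟩, hmin⟩ := ((isCompact_closedBall w₁ 1).prod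
    ((isCompact_closedBall u₁ 1).inter_left hQ)).exists_isMinOn
    ⟨(w₁, u₁), by simp, hw₁, by simp⟩ hcont.continuousOn
  simp only at huQ huB hwB
  have hbound : ‖w - w₁‖ ^ 2 + ‖u - u₁‖ ^ 2 ≤ M * s := by
    have h1 : G (w, u) ≤ G (w₁, u₁) := hmin ⟨by simp, hw₁, by simp⟩
    simp only [hG, ← hu₁, sub_self, norm_zero, ne_eq, OfNat.ofNat_ne_zero, not_false_eq_true,
      zero_pow, zero_add, add_zero, Real.sqrt_sq hs.le] at h1
    have h2 := hpen w u huQ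
    have h3 := mul_le_mul_of_nonneg_left (norm_le_sqrt_norm_sq_add hs2.le (A w + b - u)) hM
    linarith
  have hw1 : ‖w - w₁‖ ^ 2 ≤ M * s := by linarith [sq_nonneg ‖u - u₁‖]
  have hu1 : ‖u - u₁‖ ^ 2 ≤ M * s := by linarith [sq_nonneg ‖w - w₁‖]
  -- As `M * s < 1`, the minimizer is interior to both unit balls, so only `q ∈ Q` constrains it:
  -- stationarity in `q` gives the normal, stationarity in `w` the equation.
  have hwI : w ∈ Metric.ball w₁ 1 := by
    rw [mem_ball_iff_norm]
    nlinarith [norm_nonneg (w - w₁)]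
  have huI : u ∈ Metric.ball u₁ 1 := by
    rw [mem_ball_iff_norm]
    nlinarith [norm_nonneg (u - u₁)]
  set N := (Real.sqrt (‖A w + b - u‖ ^ 2 + s ^ 2))⁻¹ • (A w + b - u) with hN
  have hNle : ‖N‖ ≤ 1 := norm_inv_sqrt_smul_le hs2 _
  have hNd := hasFDerivAt_sqrt_norm_sq_add hs2 (A w + b - u)
  rw [← hN] at hNd
  refine ⟨w, u, M • N, hw1, hu1, ?_, ?_, fun v => ?_⟩
  · rw [norm_smul, Real.norm_of_nonneg hM]
    exact mul_le_of_le_one_right hM hNle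
  · refine mem_frechetNormal_of_isLocalMinOn (G := fun q => G (w, q)) huQ ?_ ?_
    · filter_upwards [self_mem_nhdsWithin, mem_nhdsWithin_of_mem_nhds
        (Metric.isOpen_ball.mem_nhds huI)] with q hq hqB
      exact hmin ⟨hwB, hq, Metric.ball_subset_closedBall hqB⟩
    · have h1 : HasFDerivAt (fun q : F => A w + b - q) (-ContinuousLinearMap.id ℝ F) u :=
        (hasFDerivAt_id u).const_sub _
      have h2 := ((hNd.comp u h1).const_mul M).const_add (h w + ‖w - w₁‖ ^ 2)
      have h3 := ((hasFDerivAt_id u).sub_const u₁).norm_sq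
      refine (h2.add h3).congr_fderiv ?_
      ext z
      simp
      ring
  · have hloc : IsLocalMin (fun p => G (p, u)) w := by
      filter_upwards [Metric.isOpen_ball.mem_nhds hwI] with p hp
      exact hmin ⟨Metric.ball_subset_closedBall hp, huQ, huB⟩
    have h1 : HasFDerivAt (fun p : E => A p + b - u) A w :=
      (A.hasFDerivAt.add_const b).sub_const u
    have h2 := (hNd.comp w h1).const_mul M
    have h3 := ((hasFDerivAt_id w).sub_const w₁).norm_sq
    have h4 := (((hd w).hasFDerivAt.add h3).add h2).add_const (‖u - u₁‖ ^ 2)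
    have h5 := DFunLike.congr_fun (hloc.hasFDerivAt_eq_zero h4) v
    simp at h5
    rw [real_inner_smul_left, ← h5]
    simp [inner_sub_left]

/-- Existence of a multiplier in the limiting normal cone under an error bound. -/
theorem exists_multiplier {A : E →L[ℝ] F} {b : F} {Q : Set F} (hQ : IsClosed Q) {T : Set E}
    {c M : ℝ} (hc : 0 ≤ c) (hM : 0 ≤ M) {h : E → ℝ} (hd : ContDiff ℝ 1 h)
    (hlip : ∀ v w, h v ≤ h w + M * ‖v - w‖)
    (hreg : ∀ w, ∀ q ∈ Q, ∃ w' ∈ T, ‖w' - w‖ ≤ c * ‖A w + b - q‖) {w₁ : E}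
    (hw₁ : A w₁ + b ∈ Q) (hmin : ∀ w ∈ T, h w₁ ≤ h w) :
    ∃ l ∈ limitingNormal Q (A w₁ + b), ‖l‖ ≤ M * c ∧
      ∀ v, fderiv ℝ h w₁ v + inner ℝ l (A v) = 0 := by
  have hMc : 0 ≤ M * c := mul_nonneg hM hc
  -- Exact penalty: correcting `w` to a point of `T` costs at most the Lipschitz constant times the
  -- error bound.
  have hpen : ∀ w, ∀ q ∈ Q, h w₁ ≤ h w + M * c * ‖A w + b - q‖ := fun w q hq => by
    obtain ⟨w', hw', hle⟩ := hreg w q hq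
    have := mul_le_mul_of_nonneg_left hle hM
    linarith [hmin w' hw', hlip w' w]
  have hs : ∀ k : ℕ, M * c * (1 / (M * c + 1) * (1 / ((k : ℝ) + 1))) < 1 := fun k => by
    have h1 : (1 : ℝ) / ((k : ℝ) + 1) ≤ 1 := by
      rw [div_le_one (by positivity)]
      linarith [(Nat.cast_nonneg k : (0 : ℝ) ≤ k)]
    have h2 : M * c * (1 / (M * c + 1)) < 1 := by
      rw [mul_one_div, div_lt_one (by positivity)]
      linarith
    rw [← mul_assoc]
    exact lt_of_le_of_lt (mul_le_of_le_one_right (by positivity) h1) h2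
  have hslim : Tendsto (fun k : ℕ => M * c * (1 / (M * c + 1) * (1 / ((k : ℝ) + 1)))) atTop
      (𝓝 0) := by
    simpa only [mul_zero] using
      (tendsto_one_div_add_atTop_nhds_zero_nat.const_mul (1 / (M * c + 1))).const_mul (M * c)
  choose w u l hw hu hl hn heq using fun k : ℕ => exists_approx_multiplier (A := A) hQ hMc
    (hd.differentiable one_ne_zero) hw₁ hpen (s := 1 / (M * c + 1) * (1 / ((k : ℝ) + 1)))
    (by positivity) (hs k)
  have hwt : Tendsto w atTop (𝓝 w₁) := by
    rw [tendsto_iff_norm_sub_tendsto_zero]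
    have h1 := squeeze_zero (fun k => sq_nonneg ‖w k - w₁‖) hw hslim
    simpa using h1.sqrt
  have hut : Tendsto u atTop (𝓝 (A w₁ + b)) := by
    rw [tendsto_iff_norm_sub_tendsto_zero]
    have h1 := squeeze_zero (fun k => sq_nonneg ‖u k - (A w₁ + b)‖) hu hslim
    simpa using h1.sqrt
  obtain ⟨l₀, hl₀, φ, hφ, hlφ⟩ := tendsto_subseq_of_bounded (Metric.isBounded_closedBall (x := 0))
    (fun k => mem_closedBall_zero_iff.2 (hl k))
  have hφt := hφ.tendsto_atTop
  rw [Metric.isClosed_closedBall.closure_eq, mem_closedBall_zero_iff] at hl₀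
  refine ⟨l₀, ⟨hw₁, u ∘ φ, fun k => l (φ k) - (2 : ℝ) • (u (φ k) - (A w₁ + b)), hut.comp hφt, ?_,
    fun k => hn _⟩, hl₀, fun v => ?_⟩
  · simpa using hlφ.sub (((hut.comp hφt).sub_const (A w₁ + b)).const_smul (2 : ℝ))
  · have h1 : Tendsto (fun k => fderiv ℝ h (w (φ k)) v) atTop (𝓝 (fderiv ℝ h w₁ v)) :=
      (((hd.continuous_fderiv one_ne_zero).clm_apply continuous_const).tendsto w₁).comp
        (hwt.comp hφt)
    have h2 : Tendsto (fun k => 2 * inner ℝ (w (φ k) - w₁) v) atTop (𝓝 (2 * inner ℝ (w₁ - w₁) v)) :=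
      (((hwt.comp hφt).sub_const w₁).inner tendsto_const_nhds).const_mul 2
    have h3 : Tendsto (fun k => inner ℝ (l (φ k)) (A v)) atTop (𝓝 (inner ℝ l₀ (A v))) :=
      hlφ.inner tendsto_const_nhds
    have h4 := tendsto_nhds_unique ((h1.add h2).add h3)
      (tendsto_const_nhds.congr fun k => (heq (φ k) v).symm)
    simpa using h4

end

/-! ### Multipliers when the infimum is not attained -/

section

variable {E F : Type*} [NormedAddCommGroup E] [InnerProductSpace ℝ E] [FiniteDimensional ℝ E]
  [NormedAddCommGroup F] [InnerProductSpace ℝ F] [FiniteDimensional ℝ F]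

/-- Minimizing an affine function over the solution set of an inclusion with a global error bound:
there are near-minimizers carrying multipliers that converge to a multiplier of the objective. -/
theorem exists_asymptotic_multiplier {A : E →L[ℝ] F} {b : F} {Q : Set F} (hQ : IsClosed Q)
    {T : Set E} (hT : IsClosed T) (hTne : T.Nonempty) (hTQ : ∀ w ∈ T, A w + b ∈ Q) {c : ℝ}
    (hc : 0 ≤ c) (hreg : ∀ w, ∀ q ∈ Q, ∃ w' ∈ T, ‖w' - w‖ ≤ c * ‖A w + b - q‖) {p : E →L[ℝ] ℝ}
    {γ : ℝ} (hγ : ∀ w ∈ T, γ ≤ p w) :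
    ∃ (l : F) (l' : ℕ → F) (w : ℕ → E), (∀ v, p v + inner ℝ l (A v) = 0) ∧
      Tendsto l' atTop (𝓝 l) ∧ ∀ k, w k ∈ T ∧ l' k ∈ limitingNormal Q (A (w k) + b) ∧
        inner ℝ (l' k) (A (w k)) ≤ -γ + 2 * (1 / ((k : ℝ) + 1)) := by
  have key : ∀ η : ℝ, 0 < η → η ≤ 1 → ∃ (l : F) (w : E), w ∈ T ∧
      l ∈ limitingNormal Q (A w + b) ∧ ‖l‖ ≤ (‖p‖ + 1) * c ∧
      (∀ v, ‖p v + inner ℝ l (A v)‖ ≤ η * ‖v‖) ∧ inner ℝ l (A w) ≤ -γ + 2 * η := by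
    intro η hη hη1
    have hbb : BddBelow (p '' T) := ⟨γ, by rintro _ ⟨w, hw, rfl⟩; exact hγ w hw⟩
    obtain ⟨_, ⟨w₀, hw₀, rfl⟩, hw₀lt⟩ := exists_lt_of_csInf_lt (hTne.image p)
      (lt_add_of_pos_right (sInf (p '' T)) hη)
    have hinf : ∀ w ∈ T, p w₀ - η ≤ p w := fun w hw => by
      linarith [csInf_le hbb ⟨w, hw, rfl⟩]
    -- The final estimate loses `a` from the perturbation at `w₀` and `a ‖w₀‖` from recentring;
    -- together they are `η`.
    obtain ⟨a, ha, haη⟩ : ∃ a : ℝ, 0 < a ∧ a * (1 + ‖w₀‖) = η :=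
      ⟨η / (1 + ‖w₀‖), by positivity, by field_simp⟩
    have haη' : a ≤ η := by nlinarith [norm_nonneg w₀]
    set h : E → ℝ := fun w => p w + a * Real.sqrt (‖w - w₀‖ ^ 2 + 1) with hh
    have hcd : ContDiff ℝ 1 h := by
      refine p.contDiff.add (contDiff_const.mul (ContDiff.sqrt ?_ fun w => by positivity))
      exact ((contDiff_id.sub contDiff_const).norm_sq ℝ).add contDiff_const
    have hlip : ∀ v w, h v ≤ h w + (‖p‖ + a) * ‖v - w‖ := fun v w => by
      have h1 : p v - p w ≤ ‖p‖ * ‖v - w‖ := by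
        rw [← map_sub]
        exact (le_abs_self _).trans (p.le_opNorm _)
      have h2 : Real.sqrt (‖v - w₀‖ ^ 2 + 1) ≤ Real.sqrt (‖w - w₀‖ ^ 2 + 1) + ‖v - w‖ := by
        refine Real.sqrt_le_iff.2 ⟨by positivity, ?_⟩
        have h3 : ‖v - w₀‖ ≤ ‖v - w‖ + ‖w - w₀‖ := norm_sub_le_norm_sub_add_norm_sub ..
        have h4 := norm_le_sqrt_norm_sq_add zero_le_one (w - w₀)
        have h5 : Real.sqrt (‖w - w₀‖ ^ 2 + 1) ^ 2 = ‖w - w₀‖ ^ 2 + 1 :=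
          Real.sq_sqrt (by positivity)
        have h6 := pow_le_pow_left₀ (norm_nonneg _) h3 2
        have h7 := mul_le_mul_of_nonneg_left h4 (norm_nonneg (v - w))
        nlinarith
      have := mul_le_mul_of_nonneg_left h2 ha.le
      simp only [hh]
      linarith
    -- Outside the ball of radius `(h w₀ - γ) / a` the bound `p ≥ γ` makes `h` exceed `h w₀`.
    have hexists : ∃ w₁ ∈ T, ∀ w ∈ T, h w₁ ≤ h w := by
      have hR : 0 ≤ (h w₀ - γ) / a := by
        refine div_nonneg ?_ ha.le
        have : 0 ≤ a * Real.sqrt (‖w₀ - w₀‖ ^ 2 + 1) := by positivity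
        have := hγ w₀ hw₀
        simp only [hh]
        linarith
      have hw₀B : w₀ ∈ T ∩ Metric.closedBall w₀ ((h w₀ - γ) / a) :=
        ⟨hw₀, Metric.mem_closedBall_self hR⟩
      obtain ⟨w₁, hw₁, hmin⟩ := ((isCompact_closedBall w₀ ((h w₀ - γ) / a)).inter_left
        hT).exists_isMinOn ⟨w₀, hw₀B⟩ hcd.continuous.continuousOn
      refine ⟨w₁, hw₁.1, fun w hw => ?_⟩
      by_cases hwB : w ∈ Metric.closedBall w₀ ((h w₀ - γ) / a)
      · exact hmin ⟨hw, hwB⟩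
      · refine (show h w₁ ≤ h w₀ from hmin hw₀B).trans ?_
        rw [mem_closedBall_iff_norm, not_le, div_lt_iff₀ ha] at hwB
        have h1 := mul_le_mul_of_nonneg_left (norm_le_sqrt_norm_sq_add zero_le_one (w - w₀)) ha.le
        have h2 := hγ w hw
        have h3 : h w = p w + a * Real.sqrt (‖w - w₀‖ ^ 2 + 1) := rfl
        linarith
    obtain ⟨w₁, hw₁, hmin⟩ := hexists
    obtain ⟨l, hl, hln, hleq⟩ := exists_multiplier hQ hc (by positivity) hcd hlip hreg
      (hTQ w₁ hw₁) hmin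
    have hN := norm_inv_sqrt_smul_le one_pos (w₁ - w₀)
    set N := (Real.sqrt (‖w₁ - w₀‖ ^ 2 + 1))⁻¹ • (w₁ - w₀) with hNdef
    have hder : ∀ v, fderiv ℝ h w₁ v = p v + a * inner ℝ N v := fun v => by
      have h1 : HasFDerivAt (fun w : E => w - w₀) (ContinuousLinearMap.id ℝ E) w₁ :=
        (hasFDerivAt_id w₁).sub_const w₀
      have h2 := p.hasFDerivAt.add
        (((hasFDerivAt_sqrt_norm_sq_add one_pos (w₁ - w₀)).comp w₁ h1).const_mul a)
      rw [HasFDerivAt.fderiv (f := h) h2]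
      simp [hNdef, real_inner_smul_left, inner_sub_left]
    have hNv : ∀ v, |a * inner ℝ N v| ≤ a * ‖v‖ := fun v => by
      rw [abs_mul, abs_of_pos ha]
      refine mul_le_mul_of_nonneg_left ?_ ha.le
      exact (abs_real_inner_le_norm N v).trans (mul_le_of_le_one_left (norm_nonneg _) hN)
    refine ⟨l, w₁, hw₁, hl, hln.trans ?_, fun v => ?_, ?_⟩
    · gcongr
      linarith
    · have h1 := hleq v
      rw [hder] at h1
      have h2 : p v + inner ℝ l (A v) = -(a * inner ℝ N v) := by linarith
      rw [h2, norm_neg]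
      exact (hNv v).trans (by gcongr)
    -- Pairing the equation with `w₁` gives `⟪l, A w₁⟫ ≤ -γ + a ‖w₁‖`. Minimality against `w₀` gives
    -- `a ‖w₁ - w₀‖ ≤ η + a`, hence `a ‖w₁‖ ≤ 2 η`.
    · have h1 := hleq w₁
      rw [hder] at h1
      have h2 := (abs_le.1 (hNv w₁)).1
      have h3 := hmin w₀ hw₀
      simp only [hh, sub_self, norm_zero, ne_eq, OfNat.ofNat_ne_zero, not_false_eq_true, zero_pow,
        zero_add, Real.sqrt_one, mul_one] at h3
      have h4 := mul_le_mul_of_nonneg_left (norm_le_sqrt_norm_sq_add zero_le_one (w₁ - w₀)) ha.le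
      have h5 := hinf w₁ hw₁
      have h6 : ‖w₁‖ ≤ ‖w₁ - w₀‖ + ‖w₀‖ := by simpa using norm_add_le (w₁ - w₀) w₀
      have h7 := mul_le_mul_of_nonneg_left h6 ha.le
      linarith [hγ w₁ hw₁]
  choose l w hw hl hln hlp hlw using fun k : ℕ => key (1 / ((k : ℝ) + 1)) (by positivity) (by
    rw [div_le_one (by positivity)]
    linarith [(Nat.cast_nonneg k : (0 : ℝ) ≤ k)])
  obtain ⟨l₀, -, φ, hφ, hlφ⟩ := tendsto_subseq_of_bounded (Metric.isBounded_closedBall (x := 0))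
    (fun k => mem_closedBall_zero_iff.2 (hln k))
  refine ⟨l₀, l ∘ φ, w ∘ φ, fun v => ?_, hlφ, fun k => ⟨hw _, hl _, (hlw (φ k)).trans ?_⟩⟩
  · have h1 : Tendsto (fun k => p v + inner ℝ (l (φ k)) (A v)) atTop
        (𝓝 (p v + inner ℝ l₀ (A v))) := (hlφ.inner tendsto_const_nhds).const_add _
    have h2 : Tendsto (fun k => p v + inner ℝ (l (φ k)) (A v)) atTop (𝓝 0) := by
      refine squeeze_zero_norm (fun k => hlp (φ k) v) ?_
      simpa using (tendsto_one_div_add_atTop_nhds_zero_nat.comp hφ.tendsto_atTop).mul_const ‖v‖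
    exact tendsto_nhds_unique h1 h2
  · have : (k : ℝ) ≤ φ k := by exact_mod_cast hφ.le_apply
    gcongr

end

/-! ### Support function bound and second-order expansion -/

section

variable {E F : Type*} [NormedAddCommGroup E] [InnerProductSpace ℝ E]
  [NormedAddCommGroup F] [NormedSpace ℝ F]

/-- One sequence bounds a lower limit from above. The filter `𝓝 l` is not punctured, so a constant
sequence is allowed. -/
theorem lowerGenSupport_le {Q B : Set E} {l : E} {l' u : ℕ → E} {a' : ℕ → ℝ} {a : ℝ}
    (hl : Tendsto l' atTop (𝓝 l)) (hu : ∀ k, u k ∈ B) (hn : ∀ k, l' k ∈ limitingNormal Q (u k))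
    (hle : ∀ k, inner ℝ (l' k) (u k) ≤ a' k) (ha : Tendsto a' atTop (𝓝 a)) :
    lowerGenSupport Q B l ≤ (a : EReal) := by
  rw [lowerGenSupport]
  split_ifs
  · exact bot_le
  · refine EReal.le_of_forall_lt_iff_le.1 fun z hz => liminf_le_of_frequently_le' ?_
    refine hl.frequently (Eventually.frequently ?_)
    filter_upwards [ha.eventually_lt_const (EReal.coe_lt_coe_iff.1 hz)] with k hk
    exact (iInf₂_le (u k) ⟨hn k, hu k⟩).trans (EReal.coe_le_coe_iff.2 ((hle k).trans hk.le))

/-- By symmetry of the second derivative the remainder has derivative `h'(x + v) - h'(x) - D v =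
o(v)`; the mean value inequality on the ball of radius `‖v‖` integrates it. -/
theorem taylor_two_isLittleO {h : E → F} (hh : ContDiff ℝ 2 h) (x : E) :
    (fun v => h (x + v) - h x - fderiv ℝ h x v - (1 / 2 : ℝ) • fderiv ℝ (fderiv ℝ h) x v v)
      =o[𝓝 0] fun v => ‖v‖ ^ 2 := by
  set D := fderiv ℝ (fderiv ℝ h) x with hD
  have hsymm : ∀ v w, D v w = D w v :=
    (hh.contDiffAt (x := x)).isSymmSndFDerivAt (by simp)
  have hd' : HasFDerivAt (fderiv ℝ h) D x :=
    (((hh.fderiv_right (m := 1) (by norm_num)).differentiable one_ne_zero) x).hasFDerivAt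
  have hder : ∀ v, HasFDerivAt
      (fun v => h (x + v) - h x - fderiv ℝ h x v - (1 / 2 : ℝ) • D v v)
      (fderiv ℝ h (x + v) - fderiv ℝ h x - D v) v := fun v => by
    have h1 : HasFDerivAt (fun v => h (x + v)) (fderiv ℝ h (x + v)) v :=
      (hasFDerivAt_comp_add_left x).2 ((hh.differentiable two_ne_zero) _).hasFDerivAt
    have h2 : HasFDerivAt (fun v => D v v) _ v := D.hasFDerivAt.clm_apply (hasFDerivAt_id v)
    refine (((h1.sub_const (h x)).sub (fderiv ℝ h x).hasFDerivAt).sub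
      (h2.const_smul (1 / 2 : ℝ))).congr_fderiv ?_
    ext z
    simp only [hsymm z v, sub_apply, smul_apply,
      add_apply, ContinuousLinearMap.comp_apply, ContinuousLinearMap.id_apply,
      ContinuousLinearMap.flip_apply]
    rw [← two_smul ℝ (D v z), smul_smul]
    norm_num
  have hlo : (fun v => fderiv ℝ h (x + v) - fderiv ℝ h x - D v) =o[𝓝 0] fun v => v :=
    hasFDerivAt_iff_isLittleO_nhds_zero.1 hd'
  refine Asymptotics.isLittleO_iff.2 fun ε hε => ?_
  obtain ⟨ρ, hρ, hball⟩ := Metric.eventually_nhds_iff_ball.1 (hlo.def hε)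
  filter_upwards [Metric.ball_mem_nhds (0 : E) hρ] with v hv
  have := (convex_closedBall (0 : E) ‖v‖).norm_image_sub_le_of_norm_hasFDerivWithin_le
    (f := fun v => h (x + v) - h x - fderiv ℝ h x v - (1 / 2 : ℝ) • D v v) (C := ε * ‖v‖)
    (fun z _ => (hder z).hasFDerivWithinAt) (fun z hz => ?_) (x := 0) (y := v) (by simp) (by simp)
  · simpa [pow_two, mul_assoc] using this
  · rw [mem_closedBall_zero_iff] at hz
    refine (hball z ?_).trans (by gcongr)
    rw [mem_ball_zero_iff] at hv ⊢
    exact lt_of_le_of_lt hz hv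

/-- The displacement is `t e` with `e = d + ½ r w' → d`. Over `½ t r`, the quadratic term `½ t²
D(e,e)` becomes `(t/r) D(e,e)`, and the remainder `o(t²)` vanishes because `t/r` converges. -/
theorem tendsto_second_order_quotient {h : E → F} (hh : ContDiff ℝ 2 h) (x : E) {d w : E} {σ : ℝ}
    {t r : ℕ → ℝ} {w' : ℕ → E} (ht : ∀ k, 0 < t k) (hr : ∀ k, 0 < r k)
    (ht0 : Tendsto t atTop (𝓝 0)) (hr0 : Tendsto r atTop (𝓝 0))
    (htr : Tendsto (fun k => t k / r k) atTop (𝓝 σ)) (hw : Tendsto w' atTop (𝓝 w)) :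
    Tendsto (fun k => ((1 / 2 : ℝ) * t k * r k)⁻¹ •
      (h (x + t k • d + ((1 / 2 : ℝ) * t k * r k) • w' k) - h x - t k • fderiv ℝ h x d)) atTop
      (𝓝 (fderiv ℝ h x w + σ • secondDeriv h x d)) := by
  set e : ℕ → E := fun k => d + ((1 / 2 : ℝ) * r k) • w' k with he
  have hed : Tendsto e atTop (𝓝 d) := by
    simpa [he] using ((hr0.const_mul (1 / 2 : ℝ)).smul hw).const_add d
  have hv0 : Tendsto (fun k => t k • e k) atTop (𝓝 0) := by
    simpa using ht0.smul hed
  have hO : (fun k => ‖t k • e k‖ ^ 2) =O[atTop] fun k => t k ^ 2 := by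
    have h1 : (fun k => t k • e k) =O[atTop] t := by
      simpa using (Asymptotics.isBigO_refl t atTop).smul (hed.isBigO_one ℝ)
    exact h1.norm_left.pow 2
  have hR := (((taylor_two_isLittleO hh x).comp_tendsto hv0).trans_isBigO
    hO).tendsto_inv_smul_nhds_zero
  have hmain := (((fderiv ℝ h x).continuous.tendsto w).comp hw).add ((htr.smul
    ((((fderiv ℝ (fderiv ℝ h) x).continuous.clm_apply continuous_id).tendsto d).comp hed)).add
    ((htr.const_mul 2).smul hR))
  rw [smul_zero, add_zero] at hmain
  refine hmain.congr fun k => ?_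
  have ht' := (ht k).ne'
  have hr' := (hr k).ne'
  have hx : x + t k • d + ((1 / 2 : ℝ) * t k * r k) • w' k = x + t k • e k := by
    simp only [he, smul_add, smul_smul, add_assoc]
    ring_nf
  have hte : t k • fderiv ℝ h x d = fderiv ℝ h x (t k • e k) -
      ((1 / 2 : ℝ) * t k * r k) • fderiv ℝ h x (w' k) := by
    simp only [he, map_add, map_smul, smul_add, smul_smul]
    rw [show t k * (1 / 2 * r k) = 1 / 2 * t k * r k by ring]
    abel
  rw [hx, hte]
  have e1 : t k / r k = (1 / 2 * t k * r k)⁻¹ * (1 / 2 * t k * t k) := by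
    field_simp
  have e2 : 2 * (t k / r k) * (t k ^ 2)⁻¹ = (1 / 2 * t k * r k)⁻¹ := by
    field_simp
  have e3 : (1 / 2 * t k * r k)⁻¹ * (1 / 2 * t k * r k) = 1 :=
    inv_mul_cancel₀ (by positivity)
  simp only [Function.comp, id, smul_smul _ _ (_ - _), e2]
  rw [e1]
  simp only [map_smul, smul_apply]
  generalize (1 / 2 * t k * r k)⁻¹ = c at *
  generalize 1 / 2 * t k * r k = a at *
  have e4 : fderiv ℝ h x (w' k) = (c * a) • fderiv ℝ h x (w' k) := by rw [e3, one_smul]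
  rw [e4, smul_sub c _ (_ - _), smul_sub c _ (a • _), ← e4]
  conv_lhs => rw [e4]
  module

end

/-! ### Tangents as asymptotic second-order directions -/

section

variable {E : Type*} [NormedAddCommGroup E] [InnerProductSpace ℝ E]

/-- Take `r = √(t + ‖d' - d‖)`: then `t / r ≤ r`, and the correction `(2 / r)(d' - d)` has norm at
most `2 r`. -/
theorem zero_mem_secondTangent_zero {A : Set E} {x d : E} (hd : d ∈ tangentCone A x) :
    0 ∈ secondTangent 0 A x d := by
  obtain ⟨t, d', ht, ht0, hd', hA⟩ := hd
  set r : ℕ → ℝ := fun k => Real.sqrt (t k + ‖d' k - d‖) with hr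
  have hpos : ∀ k, 0 < t k + ‖d' k - d‖ := fun k => add_pos_of_pos_of_nonneg (ht k) (norm_nonneg _)
  have hrpos : ∀ k, 0 < r k := fun k => Real.sqrt_pos.2 (hpos k)
  have hr0 : Tendsto r atTop (𝓝 0) := by
    simpa [hr] using (ht0.add (tendsto_iff_norm_sub_tendsto_zero.1 hd')).sqrt
  have hsq : ∀ k, r k * r k = t k + ‖d' k - d‖ := fun k => Real.mul_self_sqrt (hpos k).le
  refine ⟨t, r, fun k => (2 / r k) • (d' k - d), ht, hrpos, ht0, hr0, ?_, ?_, fun k => ?_⟩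
  · refine squeeze_zero (fun k => (div_pos (ht k) (hrpos k)).le) (fun k => ?_) hr0
    rw [div_le_iff₀ (hrpos k), hsq]
    linarith [norm_nonneg (d' k - d)]
  · refine squeeze_zero_norm (a := fun k => 2 * r k) (fun k => ?_) (by simpa using hr0.const_mul 2)
    have hp := hrpos k
    rw [norm_smul, Real.norm_of_nonneg (by positivity), div_mul_eq_mul_div, div_le_iff₀ hp,
      mul_assoc, hsq]
    linarith [ht k]
  · convert hA k using 1
    have := (hrpos k).ne'
    rw [smul_smul, show (1 / 2 : ℝ) * t k * r k * (2 / r k) = t k by field_simp, smul_sub]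
    abel

end

/-! ### Transfer of MSCQ and quadratic growth to second-order tangents -/

section

variable {E F : Type*} [NormedAddCommGroup E] [InnerProductSpace ℝ E]
  [NormedAddCommGroup F] [InnerProductSpace ℝ F]

theorem image_mem_secondTangent {g : E → F} (hg : ContDiff ℝ 2 g) {K : Set F} {σ : ℝ} {x d w : E}
    (hw : w ∈ secondTangent σ (g ⁻¹' K) x d) :
    fderiv ℝ g x w + σ • secondDeriv g x d ∈ secondTangent σ K (g x) (fderiv ℝ g x d) := by
  obtain ⟨t, r, w', ht, hr, ht0, hr0, htr, hw, hA⟩ := hw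
  refine ⟨t, r, _, ht, hr, ht0, hr0, htr,
    tendsto_second_order_quotient hg x (d := d) ht hr ht0 hr0 htr hw, fun k => ?_⟩
  have := ht k
  have := hr k
  rw [smul_smul, mul_inv_cancel₀ (by positivity), one_smul]
  convert (show g _ ∈ K from hA k) using 1
  abel

variable [FiniteDimensional ℝ E]

/-- Metric subregularity of the constraint system passes to second-order tangents. -/
theorem exists_secondTangent_near {g : E → F} (hg : ContDiff ℝ 2 g) {K : Set F}
    (hK : IsClosed K) {σ c : ℝ} (hc : 0 ≤ c) {x : E} (hx : g x ∈ K)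
    (hreg : ∀ᶠ z in 𝓝 x, Metric.infDist z (g ⁻¹' K) ≤ c * Metric.infDist (g z) K) {d : E} (w : E)
    {q : F} (hq : q ∈ secondTangent σ K (g x) (fderiv ℝ g x d)) :
    ∃ w' ∈ secondTangent σ (g ⁻¹' K) x d,
      ‖w' - w‖ ≤ c * ‖fderiv ℝ g x w + σ • secondDeriv g x d - q‖ := by
  obtain ⟨t, r, q', ht, hr, ht0, hr0, htr, hq', hA⟩ := hq
  have ha : ∀ k, 0 < (1 / 2 : ℝ) * t k * r k := fun k => by
    have := ht k
    have := hr k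
    positivity
  have hz0 : Tendsto (fun k => x + t k • d + ((1 / 2 : ℝ) * t k * r k) • w) atTop (𝓝 x) := by
    have h1 := ((ht0.smul_const d).const_add x).add
      (((ht0.const_mul (1 / 2 : ℝ)).mul hr0).smul_const w)
    simpa using h1
  have hquot := tendsto_second_order_quotient hg x (d := d) ht hr ht0 hr0 htr
    (tendsto_const_nhds (x := w))
  obtain ⟨k₀, hk₀⟩ := eventually_atTop.1 (hz0.eventually hreg)
  have hclosed : IsClosed (g ⁻¹' K) := hK.preimage hg.continuous
  -- Projections onto the feasible set, written at scale `½ t r`. Dividing the local error bound by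
  -- this scale makes it global in `w`, with the same `c`.
  choose Z hZ hZd using fun k => hclosed.exists_infDist_eq_dist ⟨x, hx⟩
    (x + t k • d + ((1 / 2 : ℝ) * t k * r k) • w)
  obtain ⟨z, hZz⟩ : ∃ z : ℕ → E, ∀ k, Z k = x + t k • d + ((1 / 2 : ℝ) * t k * r k) • z k := by
    refine ⟨fun k => ((1 / 2 : ℝ) * t k * r k)⁻¹ • (Z k - x - t k • d), fun k => ?_⟩
    simp only [smul_smul, mul_inv_cancel₀ (ha k).ne', one_smul]
    abel
  set p : ℕ → F := fun k => ((1 / 2 : ℝ) * t k * r k)⁻¹ •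
      (g (x + t k • d + ((1 / 2 : ℝ) * t k * r k) • w) - g x - t k • fderiv ℝ g x d) with hp
  have hgp : ∀ k, g (x + t k • d + ((1 / 2 : ℝ) * t k * r k) • w) =
      g x + t k • fderiv ℝ g x d + ((1 / 2 : ℝ) * t k * r k) • p k := fun k => by
    simp only [hp, smul_smul, mul_inv_cancel₀ (ha k).ne', one_smul]
    abel
  have hle : ∀ k, k₀ ≤ k → ‖z k - w‖ ≤ c * ‖p k - q' k‖ := fun k hk => by
    have h1 := hk₀ k hk
    have h2 := mul_le_mul_of_nonneg_left (Metric.infDist_le_dist_of_mem (hA k)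
      (x := g (x + t k • d + ((1 / 2 : ℝ) * t k * r k) • w))) hc
    have h3 := h1.trans h2
    rw [hZd k, hZz k, hgp k, dist_add_left, dist_add_left, dist_smul₀, dist_smul₀,
      Real.norm_of_nonneg (ha k).le, mul_left_comm, dist_comm, dist_eq_norm, dist_eq_norm] at h3
    exact le_of_mul_le_mul_left h3 (ha k)
  have hlim : Tendsto (fun k => c * ‖p k - q' k‖) atTop
      (𝓝 (c * ‖fderiv ℝ g x w + σ • secondDeriv g x d - q‖)) :=
    ((hquot.sub hq').norm).const_mul c
  obtain ⟨C, hC⟩ := hlim.bddAbove_range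
  have hbdd : ∀ k, z (k + k₀) ∈ Metric.closedBall w C := fun k => by
    rw [mem_closedBall_iff_norm]
    exact (hle _ (Nat.le_add_left _ _)).trans (hC ⟨_, rfl⟩)
  obtain ⟨z₀, -, φ, hφ, hzφ⟩ := tendsto_subseq_of_bounded Metric.isBounded_closedBall hbdd
  have hφt : Tendsto (fun k => φ k + k₀) atTop atTop :=
    (tendsto_add_atTop_nat k₀).comp hφ.tendsto_atTop
  refine ⟨z₀, ⟨_, _, _, fun k => ht (φ k + k₀), fun k => hr (φ k + k₀), ht0.comp hφt,
    hr0.comp hφt, htr.comp hφt, hzφ, fun k => ?_⟩, ?_⟩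
  · have := hZ (φ k + k₀)
    rwa [hZz] at this
  · exact le_of_tendsto_of_tendsto' (hzφ.sub_const w).norm (hlim.comp hφt)
      fun k => hle _ (Nat.le_add_left _ _)

/-- Quadratic growth gives a second-order lower bound along second-order tangents. -/
theorem second_order_growth {f : E → ℝ} (hf : ContDiff ℝ 2 f) {Φ S : Set E} (hS : IsClosed S)
    {κ σ : ℝ} (hκ : 0 ≤ κ) {x : E} (hx : x ∈ S)
    (hgrow : ∀ᶠ z in 𝓝 x, z ∈ Φ → f x + κ * Metric.infDist z S ^ 2 ≤ f z) {d w : E}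
    (hfd : fderiv ℝ f x d ≤ 0) (hw : w ∈ secondTangent σ Φ x d) :
    2 * κ * σ * Metric.infDist d (tangentCone S x) ^ 2 ≤
      fderiv ℝ f x w + σ * secondDeriv f x d := by
  obtain ⟨t, r, w', ht, hr, ht0, hr0, htr, hw, hA⟩ := hw
  have hσ : 0 ≤ σ := ge_of_tendsto' htr fun k => (div_pos (ht k) (hr k)).le
  have hz0 : Tendsto (fun k => x + t k • d + ((1 / 2 : ℝ) * t k * r k) • w' k) atTop (𝓝 x) := by
    have h1 := ((ht0.smul_const d).const_add x).add
      (((ht0.const_mul (1 / 2 : ℝ)).mul hr0).smul hw)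
    simpa using h1
  have hquot := tendsto_second_order_quotient hf x (d := d) ht hr ht0 hr0 htr hw
  -- The nearest solutions have difference quotients `d'`, bounded because `x ∈ S`; they cluster at
  -- a tangent `d₀` of `S`, which produces the distance to the tangent cone.
  choose s hs hsd using fun k => hS.exists_infDist_eq_dist ⟨x, hx⟩
    (x + t k • d + ((1 / 2 : ℝ) * t k * r k) • w' k)
  obtain ⟨d', hd'⟩ : ∃ d' : ℕ → E, ∀ k, s k = x + t k • d' k := by
    refine ⟨fun k => (t k)⁻¹ • (s k - x), fun k => ?_⟩
    simp only [smul_smul, mul_inv_cancel₀ (ht k).ne', one_smul]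
    abel
  set e : ℕ → E := fun k => d + ((1 / 2 : ℝ) * r k) • w' k with he
  have hed : Tendsto e atTop (𝓝 d) := by
    simpa [he] using ((hr0.const_mul (1 / 2 : ℝ)).smul hw).const_add d
  have hze : ∀ k, x + t k • d + ((1 / 2 : ℝ) * t k * r k) • w' k = x + t k • e k := fun k => by
    simp only [he, smul_add, smul_smul, add_assoc]
    ring_nf
  have hdist : ∀ k, Metric.infDist (x + t k • d + ((1 / 2 : ℝ) * t k * r k) • w' k) S =
      t k * ‖e k - d' k‖ := fun k => by
    rw [hsd k, hze, hd', dist_add_left, dist_smul₀, Real.norm_of_nonneg (ht k).le, dist_eq_norm]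
  have hle : ∀ k, ‖e k - d' k‖ ≤ ‖e k‖ := fun k => by
    have := Metric.infDist_le_dist_of_mem hx
      (x := x + t k • d + ((1 / 2 : ℝ) * t k * r k) • w' k)
    rw [hdist, hze, dist_eq_norm, add_sub_cancel_left, norm_smul,
      Real.norm_of_nonneg (ht k).le] at this
    exact le_of_mul_le_mul_left this (ht k)
  obtain ⟨C, hC⟩ := hed.norm.bddAbove_range
  have hbdd : ∀ k, d' k ∈ Metric.closedBall (0 : E) (C + C) := fun k => by
    rw [mem_closedBall_zero_iff]
    have h1 : ‖d' k‖ ≤ ‖e k - d' k‖ + ‖e k‖ := by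
      rw [norm_sub_rev]
      simpa using norm_add_le (d' k - e k) (e k)
    have h2 : ‖e k‖ ≤ C := hC ⟨k, rfl⟩
    linarith [hle k]
  obtain ⟨d₀, -, φ, hφ, hdφ⟩ := tendsto_subseq_of_bounded Metric.isBounded_closedBall hbdd
  have hφt := hφ.tendsto_atTop
  have hd₀ : d₀ ∈ tangentCone S x :=
    ⟨t ∘ φ, d' ∘ φ, fun k => ht _, ht0.comp hφt, hdφ, fun k => by
      simpa only [Function.comp, ← hd'] using hs (φ k)⟩
  have hlow : 2 * κ * σ * ‖d - d₀‖ ^ 2 ≤ fderiv ℝ f x w + σ • secondDeriv f x d := by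
    have h1 : Tendsto (fun k => 2 * κ * (t (φ k) / r (φ k)) * ‖e (φ k) - d' (φ k)‖ ^ 2) atTop
        (𝓝 (2 * κ * σ * ‖d - d₀‖ ^ 2)) :=
      ((htr.comp hφt).const_mul (2 * κ)).mul (((hed.comp hφt).sub hdφ).norm.pow 2)
    refine le_of_tendsto_of_tendsto h1 (hquot.comp hφt) ?_
    filter_upwards [(hz0.comp hφt).eventually hgrow] with k hk
    have h2 := hk (hA (φ k))
    simp only [Function.comp] at h2 ⊢
    rw [hdist] at h2
    have htk := ht (φ k)
    have hrk := hr (φ k)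
    rw [smul_eq_mul, smul_eq_mul, inv_mul_eq_div, le_div_iff₀ (by positivity)]
    have h3 : 2 * κ * (t (φ k) / r (φ k)) * ‖e (φ k) - d' (φ k)‖ ^ 2 *
        (1 / 2 * t (φ k) * r (φ k)) = κ * (t (φ k) * ‖e (φ k) - d' (φ k)‖) ^ 2 := by
      field_simp
    -- Criticality of `d` lets the first-order term be dropped.
    have h4 : t (φ k) * fderiv ℝ f x d ≤ 0 := mul_nonpos_of_nonneg_of_nonpos htk.le hfd
    linarith
  refine le_trans ?_ hlow
  have h1 : Metric.infDist d (tangentCone S x) ≤ ‖d - d₀‖ := by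
    rw [← dist_eq_norm]
    exact Metric.infDist_le_dist_of_mem hd₀
  have := Metric.infDist_nonneg (x := d) (s := tangentCone S x)
  gcongr

end

/-! ### Proximal normals and the distance to the tangent cone -/

section

variable {E : Type*} [NormedAddCommGroup E] [InnerProductSpace ℝ E]

/-- No point `x + t s'` of `S` is closer to `x + τ v` than `x`; expand the squares, divide by `t`,
let `t → 0`. -/
theorem inner_nonpos_of_mem_proximalNormal {S : Set E} {x v s : E}
    (hv : v ∈ proximalNormal S x) (hs : s ∈ tangentCone S x) : inner ℝ v s ≤ 0 := by
  obtain ⟨τ, hτ, -, hdist⟩ := hv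
  obtain ⟨t, s', ht, ht0, hs', hS⟩ := hs
  have key : ∀ k, 2 * τ * inner ℝ v (s' k) ≤ t k * ‖s' k‖ ^ 2 := fun k => by
    have h1 := Metric.infDist_le_dist_of_mem (hS k) (x := x + τ • v)
    rw [← hdist, dist_add_left, add_sub_cancel_left, dist_eq_norm] at h1
    have h2 := pow_le_pow_left₀ (norm_nonneg _) h1 2
    rw [norm_sub_sq_real, real_inner_smul_left, real_inner_smul_right, norm_smul (t k),
      Real.norm_of_nonneg (ht k).le] at h2
    have h3 : t k * (2 * τ * inner ℝ v (s' k)) ≤ t k * (t k * ‖s' k‖ ^ 2) := by nlinarith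
    exact le_of_mul_le_mul_left h3 (ht k)
  have h1 : Tendsto (fun k => 2 * τ * inner ℝ v (s' k)) atTop (𝓝 (2 * τ * inner ℝ v s)) :=
    (tendsto_const_nhds.inner hs').const_mul _
  have h2 := le_of_tendsto_of_tendsto' h1 (ht0.mul (hs'.norm.pow 2)) key
  rw [zero_mul] at h2
  exact nonpos_of_mul_nonpos_right h2 (by positivity)

theorem zero_mem_proximalNormal {S : Set E} {x : E} (hx : x ∈ S) : 0 ∈ proximalNormal S x :=
  ⟨1, one_pos, by
    rw [smul_zero, add_zero]
    exact ⟨subset_closure hx, by rw [sub_self, norm_zero, Metric.infDist_zero_of_mem hx]⟩⟩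

theorem zero_mem_tangentCone {S : Set E} {x : E} (hx : x ∈ S) : 0 ∈ tangentCone S x :=
  ⟨fun k => 1 / ((k : ℝ) + 1), fun _ => 0, fun _ => Nat.one_div_pos_of_nat,
    tendsto_one_div_add_atTop_nhds_zero_nat, tendsto_const_nhds, fun k => by simpa using hx⟩

/-- For a proximal normal `v` almost within `ε ‖d‖` of `d` and a tangent `s`, polarity gives `‖v‖ ≤
‖v - s‖`. Replacing `d` by `v` on both sides costs `‖d - v‖` twice, hence `2 ε`. -/
theorem infDist_tangentCone_ge_of_mem_epsProximalNormal {S : Set E} {x d : E} {ε : ℝ}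
    (hx : x ∈ S) (hd : d ∈ epsProximalNormal ε S x) :
    (1 - 2 * ε) * ‖d‖ ≤ Metric.infDist d (tangentCone S x) := by
  refine (Metric.le_infDist ⟨0, zero_mem_tangentCone hx⟩).2 fun {s} hs => ?_
  refine le_of_forall_pos_le_add fun η hη => ?_
  obtain ⟨v, hv, hdv⟩ := (Metric.infDist_lt_iff ⟨0, zero_mem_proximalNormal hx⟩).1
    (lt_of_le_of_lt hd (lt_add_of_pos_right (ε * ‖d‖) (half_pos hη)))
  have h1 : ‖v‖ ≤ ‖v - s‖ := by
    refine pow_le_pow_iff_left₀ (norm_nonneg _) (norm_nonneg _) two_ne_zero |>.1 ?_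
    rw [norm_sub_sq_real]
    nlinarith [inner_nonpos_of_mem_proximalNormal hv hs, sq_nonneg ‖s‖]
  have h2 : ‖d‖ ≤ ‖d - v‖ + ‖v‖ := by simpa using norm_add_le (d - v) v
  have h3 : ‖v - s‖ ≤ ‖d - v‖ + ‖d - s‖ := by
    rw [norm_sub_rev d v]
    exact norm_sub_le_norm_sub_add_norm_sub ..
  rw [dist_eq_norm] at hdv ⊢
  linarith

end

/-! ### The two assertions at a fixed solution -/

section

variable {n m : ℕ} {f : EuclideanSpace ℝ (Fin n) → ℝ}
  {g : EuclideanSpace ℝ (Fin n) → EuclideanSpace ℝ (Fin m)} {K : Set (EuclideanSpace ℝ (Fin m))}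

theorem hasFDerivAt_lagrangian (hf : Differentiable ℝ f) (hg : Differentiable ℝ g)
    (l : EuclideanSpace ℝ (Fin m)) (x : EuclideanSpace ℝ (Fin n)) :
    HasFDerivAt (fun z => lagrangian f g z l)
      (fderiv ℝ f x + (innerSL ℝ l).comp (fderiv ℝ g x)) x := by
  have h1 := (hf x).hasFDerivAt.add ((innerSL ℝ l).hasFDerivAt.comp x (hg x).hasFDerivAt)
  refine h1.congr_of_eventuallyEq (Eventually.of_forall fun z => ?_)
  simp [lagrangian, real_inner_comm]

theorem secondDeriv_lagrangian (hf : ContDiff ℝ 2 f) (hg : ContDiff ℝ 2 g)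
    (l : EuclideanSpace ℝ (Fin m)) (x d : EuclideanSpace ℝ (Fin n)) :
    secondDeriv (fun z => lagrangian f g z l) x d =
      secondDeriv f x d + inner ℝ l (secondDeriv g x d) := by
  have h1 : fderiv ℝ (fun z => lagrangian f g z l) =
      fun z => fderiv ℝ f z + (innerSL ℝ l).comp (fderiv ℝ g z) := funext fun z =>
    (hasFDerivAt_lagrangian (hf.differentiable two_ne_zero) (hg.differentiable two_ne_zero)
      l z).fderiv
  have h2 := ((hf.fderiv_right (m := 1) (by norm_num)).differentiable one_ne_zero x).hasFDerivAt
  have h3 := ((hg.fderiv_right (m := 1) (by norm_num)).differentiable one_ne_zero x).hasFDerivAt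
  have h4 := h2.add ((hasFDerivAt_const (innerSL ℝ l) x).clm_comp h3)
  rw [secondDeriv, h1, HasFDerivAt.fderiv (f := fun z => fderiv ℝ f z +
    (innerSL ℝ l).comp (fderiv ℝ g z)) h4]
  simp [secondDeriv]

theorem mem_dirMultipliers (hf : Differentiable ℝ f) (hg : Differentiable ℝ g)
    {x d : EuclideanSpace ℝ (Fin n)} {l : EuclideanSpace ℝ (Fin m)}
    (h : ∀ v, fderiv ℝ f x v + inner ℝ l (fderiv ℝ g x v) = 0)
    (hl : l ∈ dirLimitingNormal K (g x) (fderiv ℝ g x d)) : l ∈ dirMultipliers f g K x d := by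
  refine ⟨?_, hl⟩
  rw [(hasFDerivAt_lagrangian hf hg l x).fderiv]
  ext v
  simpa using h v

theorem isClosed_solutions (hf : Continuous f) (hg : Continuous g) (hK : IsClosed K) :
    IsClosed (solutions f g K) := by
  have : solutions f g K = g ⁻¹' K ∩ ⋂ z ∈ feasible g K, {x | f x ≤ f z} := by
    ext x
    simp [solutions, feasible]
  rw [this]
  exact (hK.preimage hg).inter
    (isClosed_biInter fun z _ => isClosed_le hf continuous_const)

theorem firstAssertion_of_local (hf : ContDiff ℝ 2 f) (hg : ContDiff ℝ 2 g) (hK : IsClosed K)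
    {κ c : ℝ} (hκ : 0 ≤ κ) (hc : 0 ≤ c) {x d : EuclideanSpace ℝ (Fin n)}
    (hx : x ∈ solutions f g K)
    (hreg : ∀ᶠ z in 𝓝 x, Metric.infDist z (g ⁻¹' K) ≤ c * Metric.infDist (g z) K)
    (hgrow : ∀ᶠ z in 𝓝 x, z ∈ feasible g K →
      f x + κ * Metric.infDist z (solutions f g K) ^ 2 ≤ f z)
    (hd : d ∈ criticalCone f g K x) : FirstAssertion f g K x d := by
  have hregT : ∀ w, ∀ q ∈ secondTangent 0 K (g x) (fderiv ℝ g x d),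
      ∃ w' ∈ secondTangent 0 (g ⁻¹' K) x d, ‖w' - w‖ ≤ c * ‖fderiv ℝ g x w + 0 - q‖ :=
    fun w q hq => by simpa using exists_secondTangent_near hg hK hc hx.1 hreg w hq
  have h0 : (0 : EuclideanSpace ℝ (Fin m)) ∈ secondTangent 0 K (g x) (fderiv ℝ g x d) :=
    zero_mem_secondTangent_zero hd.1
  -- The error bound at `w = 0`, `q = 0` has right-hand side zero, so the feasible tangent it yields
  -- is `0` itself.
  have h0Φ : (0 : EuclideanSpace ℝ (Fin n)) ∈ secondTangent 0 (g ⁻¹' K) x d := by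
    obtain ⟨w', hw', hle⟩ := hregT 0 0 h0
    simp only [map_zero, add_zero, sub_zero, norm_zero, mul_zero, norm_le_zero_iff] at hle
    rwa [hle] at hw'
  obtain ⟨l, hl, -, hleq⟩ := exists_multiplier (A := fderiv ℝ g x) (b := 0) (h := fderiv ℝ f x)
    (M := ‖fderiv ℝ f x‖) (w₁ := 0)
    (isClosed_secondTangent _ _ _ _) hc (norm_nonneg _) (fderiv ℝ f x).contDiff
    (fun v w => by
      have : fderiv ℝ f x v - fderiv ℝ f x w ≤ ‖fderiv ℝ f x‖ * ‖v - w‖ := by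
        rw [← map_sub]
        exact (le_abs_self _).trans ((fderiv ℝ f x).le_opNorm _)
      linarith) hregT (by simpa using h0)
    (fun w hw => by
      simpa using second_order_growth hf (isClosed_solutions hf.continuous hg.continuous hK) hκ hx
        hgrow hd.2 hw)
  simp only [map_zero, add_zero, ContinuousLinearMap.fderiv] at hl hleq
  have hsupp : ∀ A : Set (EuclideanSpace ℝ (Fin m)), (0 : EuclideanSpace ℝ (Fin m)) ∈ A →
      lowerGenSupport (imageAsymptotic g K x d) A l ≤ 0 := fun A hA =>
    lowerGenSupport_le (l' := fun _ => l) (u := fun _ => 0) (a' := fun _ => 0) tendsto_const_nhds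
      (fun _ => hA) (fun _ => hl) (fun _ => by simp) tendsto_const_nhds
  exact ⟨l, mem_dirMultipliers (hf.differentiable two_ne_zero) (hg.differentiable two_ne_zero)
    hleq (limitingNormal_secondTangent_subset hK hl),
    fun A hA => hsupp A (hA ⟨0, h0Φ, map_zero _⟩), hsupp _ (Set.mem_univ _)⟩

theorem secondAssertion_of_local (hf : ContDiff ℝ 2 f) (hg : ContDiff ℝ 2 g) (hK : IsClosed K)
    {κ c : ℝ} (hκ : 0 ≤ κ) (hc : 0 ≤ c) {x d : EuclideanSpace ℝ (Fin n)}
    (hx : x ∈ solutions f g K)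
    (hreg : ∀ᶠ z in 𝓝 x, Metric.infDist z (g ⁻¹' K) ≤ c * Metric.infDist (g z) K)
    (hgrow : ∀ᶠ z in 𝓝 x, z ∈ feasible g K →
      f x + κ * Metric.infDist z (solutions f g K) ^ 2 ≤ f z)
    (hd : d ∈ criticalCone f g K x) : SecondAssertion f g K x d
      (2 * κ * Metric.infDist d (tangentCone (solutions f g K) x) ^ 2) := by
  intro hne
  rw [imageOuter, outerSecondTangent_eq] at hne
  obtain ⟨q₀, hq₀⟩ := hne
  have hregT : ∀ w, ∀ q ∈ secondTangent 1 K (g x) (fderiv ℝ g x d),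
      ∃ w' ∈ secondTangent 1 (g ⁻¹' K) x d,
        ‖w' - w‖ ≤ c * ‖fderiv ℝ g x w + secondDeriv g x d - q‖ :=
    fun w q hq => by
      simpa only [one_smul] using exists_secondTangent_near hg hK hc hx.1 hreg w hq
  obtain ⟨w₀, hw₀, -⟩ := hregT 0 q₀ hq₀
  obtain ⟨l, l', w, hleq, hl', hw⟩ := exists_asymptotic_multiplier (p := fderiv ℝ f x)
    (γ := 2 * κ * Metric.infDist d (tangentCone (solutions f g K) x) ^ 2 - secondDeriv f x d)
    (isClosed_secondTangent _ _ _ _) (isClosed_secondTangent _ _ _ _) ⟨w₀, hw₀⟩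
    (fun w hw => by simpa only [one_smul] using image_mem_secondTangent hg hw) hc hregT
    (fun w hw => by
      have := second_order_growth hf (isClosed_solutions hf.continuous hg.continuous hK) hκ hx
        hgrow hd.2 hw
      linarith)
  set β := Metric.infDist d (tangentCone (solutions f g K) x)
  have hl : l ∈ dirLimitingNormal K (g x) (fderiv ℝ g x d) :=
    (isClosed_dirLimitingNormal _ _ _).mem_of_tendsto hl'
      (Eventually.of_forall fun k => limitingNormal_secondTangent_subset hK (hw k).2.1)
  have hsupp : ∀ B : Set (EuclideanSpace ℝ (Fin m)), omegaSet g K x d ⊆ B →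
      ((secondDeriv (fun z => lagrangian f g z l) x d : ℝ) : EReal) -
        lowerGenSupport (imageOuter g K x d) B l ≥ ((2 * κ * β ^ 2 : ℝ) : EReal) := by
    intro B hB
    -- Shifting by `∇²g(x)(d,d)` turns the bound on `⟪l', ∇g(x) w⟫` into one on `⟪l', u⟫`; its limit
    -- is `∇²L(d,d) - 2 κ β²`.
    have hlim : Tendsto (fun k : ℕ => -(2 * κ * β ^ 2 - secondDeriv f x d) +
        2 * (1 / ((k : ℝ) + 1)) + inner ℝ (l' k) (secondDeriv g x d)) atTop
        (𝓝 (-(2 * κ * β ^ 2 - secondDeriv f x d) + 2 * 0 + inner ℝ l (secondDeriv g x d))) :=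
      ((tendsto_one_div_add_atTop_nhds_zero_nat.const_mul 2).const_add _).add
        (hl'.inner tendsto_const_nhds)
    have hle := lowerGenSupport_le (Q := imageOuter g K x d) (B := B)
      (u := fun k => fderiv ℝ g x (w k) + secondDeriv g x d) hl'
      (fun k => hB ⟨w k, by rw [outerSecondTangent_eq]; exact (hw k).1, rfl⟩)
      (fun k => by rw [imageOuter, outerSecondTangent_eq]; exact (hw k).2.1)
      (fun k => by rw [inner_add_right]; linarith [(hw k).2.2]) hlim
    calc ((2 * κ * β ^ 2 : ℝ) : EReal) =
        ((secondDeriv (fun z => lagrangian f g z l) x d : ℝ) : EReal) -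
          ((-(2 * κ * β ^ 2 - secondDeriv f x d) + 2 * 0 + inner ℝ l (secondDeriv g x d) : ℝ) :
            EReal) := by
          rw [secondDeriv_lagrangian hf hg, ← EReal.coe_sub]
          congr 1
          ring
      _ ≤ _ := EReal.sub_le_sub le_rfl hle
  exact ⟨l, mem_dirMultipliers (hf.differentiable two_ne_zero) (hg.differentiable two_ne_zero)
    hleq hl, hsupp, hsupp _ (Set.subset_univ _)⟩

theorem SecondAssertion.mono {x d : EuclideanSpace ℝ (Fin n)} {a b : ℝ} (hab : a ≤ b)
    (h : SecondAssertion f g K x d b) : SecondAssertion f g K x d a := fun hne => by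
  obtain ⟨l, hl, h1, h2⟩ := h hne
  have hab' : (a : EReal) ≤ b := EReal.coe_le_coe_iff.2 hab
  exact ⟨l, hl, fun B hB => hab'.trans (h1 B hB), hab'.trans h2⟩

end

end WeakSharp

/-! ### Localization from `xbar` to nearby solutions -/

theorem theorem3p8 {n m : ℕ} (f : EuclideanSpace ℝ (Fin n) → ℝ)
    (g : EuclideanSpace ℝ (Fin n) → EuclideanSpace ℝ (Fin m))
    (K : Set (EuclideanSpace ℝ (Fin m)))
    (hf : ContDiff ℝ 2 f) (hg : ContDiff ℝ 2 g) (hK : IsClosed K)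
    (xbar : EuclideanSpace ℝ (Fin n)) (κ δ : ℝ)
    (hmin : WeakSharp.IsWeakSharpMinimizer f g K xbar κ δ)
    (hmscq : WeakSharp.MSCQ g K xbar)
    (ε : ℝ) (hε : ε ∈ Set.Ico (0 : ℝ) (1 / 2)) :
    ∃ δ' ∈ Set.Ioo (0 : ℝ) δ,
      ∀ x ∈ WeakSharp.solutions f g K ∩ Metric.ball xbar δ',
        (∀ d ∈ WeakSharp.criticalCone f g K x ∩
            WeakSharp.epsProximalNormal ε (WeakSharp.solutions f g K) x,
          WeakSharp.FirstAssertion f g K x d ∧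
          WeakSharp.SecondAssertion f g K x d (2 * κ * (1 - 2 * ε) ^ 2 * ‖d‖ ^ 2)) ∧
        (∀ d ∈ WeakSharp.criticalCone f g K x,
          WeakSharp.FirstAssertion f g K x d ∧
          WeakSharp.SecondAssertion f g K x d
            (2 * κ * Metric.infDist d
              (WeakSharp.tangentCone (WeakSharp.solutions f g K) x) ^ 2)) := by
  obtain ⟨hκ, hδ, hxbar, -, hgrowth⟩ := hmin
  obtain ⟨-, ρ, r, c, hρ, hr, hc, hsub⟩ := hmscq
  have hm : 0 < min δ r := lt_min hδ hr
  refine ⟨min δ r / 2, ⟨by positivity, by linarith [min_le_left δ r]⟩, fun x hx => ?_⟩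
  obtain ⟨hxS, hxball⟩ := hx
  have hxmin : x ∈ Metric.ball xbar (min δ r) := Metric.ball_subset_ball (by linarith) hxball
  have hnear : ∀ᶠ z in 𝓝 x, z ∈ Metric.ball xbar (min δ r) := Metric.isOpen_ball.mem_nhds hxmin
  have hreg : ∀ᶠ z in 𝓝 x, Metric.infDist z (g ⁻¹' K) ≤ c * Metric.infDist (g z) K := by
    filter_upwards [hnear] with z hz
    -- In direction `0` the angular condition of `dirNhd` is vacuous, leaving a closed ball.
    have := hsub (z - xbar) ⟨?_, by simp⟩
    · rwa [add_sub_cancel] at this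
    · rw [mem_ball_iff_norm] at hz
      exact hz.le.trans (min_le_right _ _)
  have hgrow : ∀ᶠ z in 𝓝 x, z ∈ WeakSharp.feasible g K →
      f x + κ * Metric.infDist z (WeakSharp.solutions f g K) ^ 2 ≤ f z := by
    filter_upwards [hnear] with z hz hzΦ
    have h1 := hgrowth z ⟨hzΦ, Metric.ball_subset_ball (min_le_left _ _) hz⟩
    -- Global optimality of `x` recentres the growth condition from `xbar` to `x`.
    have h2 := hxS.2 xbar hxbar
    linarith
  have hsecond : ∀ d ∈ WeakSharp.criticalCone f g K x,
      WeakSharp.FirstAssertion f g K x d ∧ WeakSharp.SecondAssertion f g K x d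
        (2 * κ * Metric.infDist d (WeakSharp.tangentCone (WeakSharp.solutions f g K) x) ^ 2) :=
    fun d hd => ⟨WeakSharp.firstAssertion_of_local hf hg hK hκ.le hc.le hxS hreg hgrow hd,
      WeakSharp.secondAssertion_of_local hf hg hK hκ.le hc.le hxS hreg hgrow hd⟩
  refine ⟨fun d hd => ⟨(hsecond d hd.1).1, (hsecond d hd.1).2.mono ?_⟩, hsecond⟩
  have h1 := WeakSharp.infDist_tangentCone_ge_of_mem_epsProximalNormal hxS hd.2
  have h2 : 0 ≤ 1 - 2 * ε := by linarith [hε.2]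
  rw [mul_assoc, ← mul_pow]
  gcongr
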